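/- Let $\beta>0$ and let $S$ be a finite-dimensional quantum system with Hamiltonian $H=\sum_i E_i|E_i\rangle\langle E_i|$ (degenerate levels allowed). **Thermal Operations.** A thermal operation on a system with Hamiltonian $H$ is a map $\rho\mapsto \mathrm{Tr}_B[U(\rho\otimes\gamma_B)U^\dagger]$, where $B$ is a finite-dimensional bath with arbitrary Hamiltonian $H_B$, $\gamma_B=e^{-\beta H_B}/\mathrm{Tr}\,e^{-\beta H_B}$, and $U$ is a unitary with $[U,H\otimes 1+1\otimes H_B]=0$. We write $\rho\stackrel{TO}{\longrightarrow}\sigma$ if $\sigma$ can be approximated to arbitrary accuracy by images of $\rho$ under thermal operations. **Work of transition.** For $W\in\mathbb R$ let the work system be a two-level system with ground state $|0\rangle$, excited state $|W\rangle$ and Hamiltonian $|W|\,|W\rangle\langle W|$ (the gap is the absolute value of $W$). Call $W$ achievable for $\rho\to\sigma$ if $$\rho\otimes|W\rangle\langle W|\stackrel{TO}{\longrightarrow}\sigma\otimes|0\rangle\langle 0|\ \ (W\le 0),\qquad \rho\otimes|0\rangle\langle 0|\stackrel{TO}{\longrightarrow}\sigma\otimes|W\rangle\langle W|\ \ (W>0).$$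 The deterministic work of transition is $W_{\rho\to\sigma}=\sup\{W: W\text{ achievable}\}\in[-\infty,\infty]$. **Monotones.** For a state $\rho$ let $\rho_D=\sum_c P_c\rho P_c$, with $P_c$ the projections onto the eigenspaces of $H$, and let $\eta_i$ be the eigenvalues of $\rho_D$ (on the eigenspaces of $H$), $\eta_i$ belonging to energy $E_i$. Order the pairs so that $\eta_ie^{\beta E_i}$ is non-increasing ($\beta$-order); write $\eta_i^{(\rho)},E_i^{(\rho)}$ for the ordered lists. The thermo-majorization curve of $\rho$ is the polygonal line joining $(0,0)$ and the points $\big(\sum_{i\le k}e^{-\beta E_i^{(\rho)}},\sum_{i\le k}\eta_i^{(\rho)}\big)$, $k=1,\dots,n$. For $y\in[0,1]$, $\tilde L_y(\rho)$ is the shortest horizontal distance between this curve and the $y$-axis at height $y$. Let $\mathcal D(\sigma)=\big\{\sum_{i\le k}\zeta_i^{(\sigma)}: 1\le k\le \mathrm{rank}(\sigma_D)\big\}$, where $\zeta_i^{(\sigma)}$ are the $\beta$-ordered eigenvalues of $\sigma_D$. **Lemma.** Let $\rho,\sigma$ be states of $S$. If $\sigma$ is block-diagonal in the energy eigenbasis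 ($\sigma=\sigma_D$), then there is a largest achievable $W$ (so that $W_{\rho\to\sigma}$ is finite and achievable), and $$e^{-\beta W_{\rho\to\sigma}}=\max_{y\in\mathcal D(\sigma)}\frac{\tilde L_y(\rho)}{\tilde L_y(\sigma)}.$$ For arbitrary $\sigma$, the right-hand side is a lower bound for $e^{-\beta W_{\rho\to\sigma}}$ (with $e^{-\beta W}=+\infty$ if $W=-\infty$, i.e. if no $W$ is achievable). -/

import Mathlib

open scoped Kronecker ENNReal ComplexOrder

noncomputable section

namespace ThermalWork

/-- A density matrix of a system with finitely many levels. The index set `S` labels a fixed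
orthonormal basis of energy eigenvectors `|E_i⟩`; the Hamiltonian of the system is
`∑ i, E i |E_i⟩⟨E_i|`, with real energies `E : S → ℝ` (degenerate levels are allowed). -/
structure DensityMatrix (S : Type*) [Fintype S] where
  val : Matrix S S ℂ
  posSemidef : val.PosSemidef
  trace_eq_one : val.trace = 1

section Systems

variable {S : Type*} [Fintype S] [DecidableEq S]

/-- The Hamiltonian `∑ i, E i |E_i⟩⟨E_i|`. -/
def hamiltonian (E : S → ℝ) : Matrix S S ℂ :=
  Matrix.diagonal fun i => (E i : ℂ)

/-- Energies of two non-interacting systems: `H ⊗ 1 + 1 ⊗ H'` has eigenvalue `E i + F j` on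
`|E_i⟩ ⊗ |F_j⟩`. -/
def totalEnergy {B : Type*} (E : S → ℝ) (F : B → ℝ) : S × B → ℝ :=
  fun p => E p.1 + F p.2

/-- The Gibbs state `exp (-β H) / tr exp (-β H)` of `H = ∑ i, E i |E_i⟩⟨E_i|`. -/
def gibbsState (β : ℝ) (E : S → ℝ) : Matrix S S ℂ :=
  Matrix.diagonal fun i => ((Real.exp (-β * E i) / ∑ j, Real.exp (-β * E j) : ℝ) : ℂ)

/-- The trace over the second tensor factor. -/
def partialTrace {B : Type*} [Fintype B] (M : Matrix (S × B) (S × B) ℂ) : Matrix S S ℂ :=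
  Matrix.of fun i j => ∑ b, M (i, b) (j, b)

/-- The matrices `Tr_B [U (ρ ⊗ γ_B) U†]` obtained from `ρ` by one thermal operation: append a
finite bath `B`, with any Hamiltonian, in its Gibbs state `γ_B` at inverse temperature `β`; apply
a unitary that commutes with the total Hamiltonian; discard the bath. -/
def thermalOutputs (β : ℝ) (E : S → ℝ) (ρ : Matrix S S ℂ) : Set (Matrix S S ℂ) :=
  {τ | ∃ (b : ℕ) (_ : 0 < b) (F : Fin b → ℝ) (U : Matrix (S × Fin b) (S × Fin b) ℂ),
    U ∈ Matrix.unitaryGroup (S × Fin b) ℂ ∧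
    Commute U (hamiltonian (totalEnergy E F)) ∧
    τ = partialTrace (U * (ρ ⊗ₖ gibbsState β F) * U.conjTranspose)}

/-- `ρ ⟶ σ` under thermal operations: `σ` can be prepared from `ρ` to arbitrary accuracy (the
bath may be as large as the accuracy demands). -/
def Transition (β : ℝ) (E : S → ℝ) (ρ σ : Matrix S S ℂ) : Prop :=
  σ ∈ closure (thermalOutputs β E ρ)

/-- Energies of the work system `w |W⟩⟨W|` with ground state `0` and excited state `1`. -/
def workEnergy (w : ℝ) : Fin 2 → ℝ := ![0, w]

/-- The pure states `|0⟩⟨0|` and `|W⟩⟨W|` (`k = 0` and `k = 1`) of the work system. -/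
def workState (k : Fin 2) : Matrix (Fin 2) (Fin 2) ℂ := Matrix.single k k 1

/-- The amounts of work `W` with which the transition from `ρ` to `σ` is possible: `|W|` is the gap
of the work system, which is spent (`W ≤ 0`) or charged (`0 < W`). -/
def achievableWork (β : ℝ) (E : S → ℝ) (ρ σ : DensityMatrix S) : Set ℝ :=
  {W | (W ≤ 0 → Transition β (totalEnergy E (workEnergy |W|))
          (ρ.val ⊗ₖ workState 1) (σ.val ⊗ₖ workState 0)) ∧
       (0 < W → Transition β (totalEnergy E (workEnergy |W|))
          (ρ.val ⊗ₖ workState 0) (σ.val ⊗ₖ workState 1))}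

/-- The deterministic work of transition: the optimal (largest) work. It is extended-real valued,
as for a target with coherences no finite amount of work need suffice. -/
def workOfTransition (β : ℝ) (E : S → ℝ) (ρ σ : DensityMatrix S) : EReal :=
  sSup ((fun W : ℝ => (W : EReal)) '' achievableWork β E ρ σ)

/-- No coherences between different energies. -/
def IsBlockDiagonal (E : S → ℝ) (σ : DensityMatrix S) : Prop :=
  ∀ i j, E i ≠ E j → σ.val i j = 0

/-- The block `P_c ρ P_c` of `ρ` on the eigenspace of energy `c`. The decohered state is
`ρ_D = ∑ c, P_c ρ P_c`, the direct sum of these blocks. -/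
def energyBlock (E : S → ℝ) (ρ : DensityMatrix S) (c : ℝ) :
    Matrix {i // E i = c} {i // E i = c} ℂ :=
  ρ.val.submatrix Subtype.val Subtype.val

theorem energyBlock_isHermitian (E : S → ℝ) (ρ : DensityMatrix S) (c : ℝ) :
    (energyBlock E ρ c).IsHermitian :=
  ρ.posSemidef.isHermitian.submatrix _

/-- The eigenvalues `η i` of the decohered state `ρ_D`, `η i` being associated with the energy
`E i`: when `i` runs through the levels of energy `c`, `η i` runs through the eigenvalues, with
multiplicity, of the block of energy `c`. -/
def population (E : S → ℝ) (ρ : DensityMatrix S) (i : S) : ℝ :=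
  (energyBlock_isHermitian E ρ (E i)).eigenvalues ⟨i, rfl⟩

/-- A `β`-ordering: an enumeration of the levels in which `η i * exp (β * E i)` descends. -/
def betaOrder (β : ℝ) (E : S → ℝ) (ρ : DensityMatrix S) : Fin (Fintype.card S) ≃ S :=
  (Tuple.sort fun k : Fin (Fintype.card S) =>
    -(population E ρ ((Fintype.equivFin S).symm k) *
      Real.exp (β * E ((Fintype.equivFin S).symm k)))).trans (Fintype.equivFin S).symm

theorem betaOrder_antitone (β : ℝ) (E : S → ℝ) (ρ : DensityMatrix S) :
    Antitone fun k => population E ρ (betaOrder β E ρ k) * Real.exp (β * E (betaOrder β E ρ k)) := by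
  intro k l hkl
  have h := Tuple.monotone_sort (fun k : Fin (Fintype.card S) =>
    -(population E ρ ((Fintype.equivFin S).symm k) *
      Real.exp (β * E ((Fintype.equivFin S).symm k)))) hkl
  exact neg_le_neg_iff.mp h

/-- Sum of the Boltzmann weights of the first `k` levels in the `β`-order. -/
def curveX (β : ℝ) (E : S → ℝ) (ρ : DensityMatrix S) (k : ℕ) : ℝ :=
  ∑ i : Fin (Fintype.card S) with i.val < k, Real.exp (-β * E (betaOrder β E ρ i))

/-- Sum of the populations of the first `k` levels in the `β`-order. -/
def curveY (β : ℝ) (E : S → ℝ) (ρ : DensityMatrix S) (k : ℕ) : ℝ :=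
  ∑ i : Fin (Fintype.card S) with i.val < k, population E ρ (betaOrder β E ρ i)

/-- The thermo-majorization curve of `ρ` (of `ρ_D` if `ρ` has coherences): the points
`(curveX k, curveY k)`, `k = 0, …, n`, the first of them `(0, 0)`, joined by segments. -/
def thermoCurve (β : ℝ) (E : S → ℝ) (ρ : DensityMatrix S) : Set (ℝ × ℝ) :=
  ⋃ k : Fin (Fintype.card S), segment ℝ
    (curveX β E ρ k.val, curveY β E ρ k.val) (curveX β E ρ (k.val + 1), curveY β E ρ (k.val + 1))

/-- The horizontal monotone `L̃_y(ρ)`: the shortest horizontal distance between the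
thermo-majorization curve and the `y`-axis at height `y`. -/
def horizontalMonotone (β : ℝ) (E : S → ℝ) (ρ : DensityMatrix S) (y : ℝ) : ℝ :=
  sInf {x | (x, y) ∈ thermoCurve β E ρ}

/-- The rank of the decohered state `ρ_D` (of `ρ` itself if `ρ` is block-diagonal). -/
def decoheredRank (E : S → ℝ) (ρ : DensityMatrix S) : ℕ :=
  Fintype.card {i // population E ρ i ≠ 0}

/-- `𝒟(σ)`: the partial sums, in the `β`-order, of the first `k` populations of `σ`, where
`1 ≤ k ≤ rank`. -/
def elbowHeights (β : ℝ) (E : S → ℝ) (σ : DensityMatrix S) : Set ℝ :=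
  curveY β E σ '' Set.Icc 1 (decoheredRank E σ)

end Systems

end ThermalWork

end

open scoped Kronecker ENNReal ComplexOrder

noncomputable section

namespace ThermalWork

/-! Everything is expressed through `excess`: for `t > 0` it is the largest value of `y - t * x` on
the thermo-majorization curve, so it records the supporting lines of that concave polygon. An amount
`W` satisfying all inequalities `L̃_y(ρ) ≤ exp (-β W) L̃_y(σ)` at the elbows `y` of `σ` is
achievable when `σ` is block-diagonal, and every achievable `W` satisfies them for any `σ`. The
optimum is therefore `W = -log M / β`, where `M` is the maximal ratio.

Necessity (`Transition.horizontalMonotone_le`): in the Heisenberg picture a thermal operation sends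
a block-diagonal effect to another one with the same Boltzmann weight (`exists_pullback_effect`). By
a Neyman–Pearson bound (`trace_effect_le`), an effect of Boltzmann weight `x` has probability at
most `t * x + excess t` in `ρ`. Testing the output with the projection onto the first levels of `σ`,
and taking for `t` the slope of a supporting line of `ρ` at that height, bounds `L̃_y(ρ)`.
Coherences of `σ` are invisible to such effects.

Sufficiency (`transition_of_excess_le`): the elbow inequalities give the excess inequalities for all
`t ≥ 0`, since the excess of `σ` is zero or attained at an elbow. By a Hahn–Banach argument
(`exists_coupling_of_excess_le`) there is then a coupling of the Boltzmann weights with themselves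
that carries the populations of `ρ` to those of `σ`. An energy-preserving permutation of system and
a large lattice bath realizes this coupling up to boundary and rounding losses (`exists_bath_perm`),
while random signs in the bath erase coherences. -/

theorem sum_eq_sum_level {S : Type*} [Fintype S] (E : S → ℝ) (c : ℝ)
    {M : Type*} [AddCommMonoid M] (f : S → M)
    (hf : ∀ i, E i ≠ c → f i = 0) : ∑ i, f i = ∑ x : {i // E i = c}, f x := by
  rw [← Finset.sum_subtype (Finset.univ.filter fun i => E i = c) (by simp) f]
  refine (Finset.sum_filter_of_ne fun i _ h => ?_).symm
  by_contra hc
  exact h (hf i hc)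

/-! ### Diagonalization within the energy eigenspaces -/

section EnergyBasis

variable {S : Type*} [Fintype S] [DecidableEq S]

/-- The columns of `energyBasis E ρ` are eigenvectors of the energy blocks of `ρ`. -/
def energyBasis (E : S → ℝ) (ρ : DensityMatrix S) : Matrix S S ℂ :=
  Matrix.of fun i j => if h : E i = E j then
    (energyBlock_isHermitian E ρ (E j)).eigenvectorUnitary.val ⟨i, h⟩ ⟨j, rfl⟩ else 0

theorem energyBasis_apply_of_ne (E : S → ℝ) (ρ : DensityMatrix S) {i j : S} (h : E i ≠ E j) :
    energyBasis E ρ i j = 0 := by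
  simp [energyBasis, h]

theorem energyBasis_apply (E : S → ℝ) (ρ : DensityMatrix S) {c : ℝ} {i j : S} (hi : E i = c)
    (hj : E j = c) : energyBasis E ρ i j =
      (energyBlock_isHermitian E ρ c).eigenvectorUnitary.val ⟨i, hi⟩ ⟨j, hj⟩ := by
  subst hj
  simp [energyBasis, hi]

theorem population_eq (E : S → ℝ) (ρ : DensityMatrix S) {c : ℝ} {i : S} (hi : E i = c) :
    population E ρ i = (energyBlock_isHermitian E ρ c).eigenvalues ⟨i, hi⟩ := by
  subst hi
  rfl

theorem energyBasis_mem_unitaryGroup (E : S → ℝ) (ρ : DensityMatrix S) :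
    energyBasis E ρ ∈ Matrix.unitaryGroup S ℂ := by
  rw [Matrix.mem_unitaryGroup_iff']
  ext j k
  rw [Matrix.mul_apply]
  by_cases hjk : E j = E k
  · rw [sum_eq_sum_level E (E j)]
    · have h : ∀ x : {i // E i = E j}, star (energyBasis E ρ) j x * energyBasis E ρ x k =
          star (energyBlock_isHermitian E ρ (E j)).eigenvectorUnitary.val ⟨j, rfl⟩ x *
          (energyBlock_isHermitian E ρ (E j)).eigenvectorUnitary.val x ⟨k, hjk.symm⟩ := by
        intro x
        rw [Matrix.star_apply, Matrix.star_apply, energyBasis_apply E ρ x.2 rfl,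
          energyBasis_apply E ρ x.2 hjk.symm]
      rw [Finset.sum_congr rfl fun x _ => h x, ← Matrix.mul_apply,
        Unitary.coe_star_mul_self, Matrix.one_apply, Matrix.one_apply]
      simp
    · intro i hi
      rw [Matrix.star_apply, energyBasis_apply_of_ne E ρ hi, star_zero, zero_mul]
  · rw [Matrix.one_apply_ne (fun h : j = k => hjk (by rw [h]))]
    refine Finset.sum_eq_zero fun i _ => ?_
    by_cases hi : E i = E j
    · rw [energyBasis_apply_of_ne E ρ (fun h => hjk (hi ▸ h)), mul_zero]
    · rw [Matrix.star_apply, energyBasis_apply_of_ne E ρ hi, star_zero, zero_mul]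

/-- Each energy block is diagonalized separately. Entries between different energies are not
covered, because `ρ` may keep coherences there. -/
theorem conj_energyBasis_apply (E : S → ℝ) (ρ : DensityMatrix S) {j k : S} (hjk : E j = E k) :
    ((energyBasis E ρ).conjTranspose * ρ.val * energyBasis E ρ) j k =
      Matrix.diagonal (fun i => (population E ρ i : ℂ)) j k := by
  have hd := (energyBlock_isHermitian E ρ (E j)).conjStarAlgAut_star_eigenvectorUnitary
  rw [Unitary.conjStarAlgAut_apply] at hd
  have hd' := congrFun (congrFun hd ⟨j, rfl⟩) ⟨k, hjk.symm⟩
  have hpop := population_eq E ρ (rfl : E j = E j)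
  rw [Matrix.mul_apply, sum_eq_sum_level E (E j)]
  · refine Eq.trans ?_ (hd'.trans ?_)
    · rw [Matrix.mul_apply]
      refine Finset.sum_congr rfl fun x _ => ?_
      rw [energyBasis_apply E ρ x.2 hjk.symm, Matrix.mul_apply, sum_eq_sum_level E (E j)]
      · rw [Matrix.mul_apply]
        simp only [Unitary.coe_star, star_star]
        congr 1
        refine Finset.sum_congr rfl fun y _ => ?_
        rw [Matrix.conjTranspose_apply, energyBasis_apply E ρ y.2 rfl]
        rfl
      · intro i hi
        rw [Matrix.conjTranspose_apply, energyBasis_apply_of_ne E ρ hi, star_zero, zero_mul]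
    · simp only [Matrix.diagonal_apply, Subtype.mk.injEq, Function.comp, ← hpop]
      rfl
  · intro i hi
    rw [energyBasis_apply_of_ne E ρ (fun h => hi (h.trans hjk.symm)), mul_zero]

theorem IsBlockDiagonal.eq_conj_diagonal {E : S → ℝ} {σ : DensityMatrix S}
    (h : IsBlockDiagonal E σ) : σ.val = energyBasis E σ *
      Matrix.diagonal (fun i => (population E σ i : ℂ)) * (energyBasis E σ).conjTranspose := by
  set V := energyBasis E σ
  have hV := energyBasis_mem_unitaryGroup E σ
  have hV0 : ∀ {i j}, E i ≠ E j → V i j = 0 := energyBasis_apply_of_ne E σ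
  have h1 : V * V.conjTranspose = 1 := Matrix.mem_unitaryGroup_iff.mp hV
  have h2 : V.conjTranspose * σ.val * V = Matrix.diagonal (fun i => (population E σ i : ℂ)) := by
    ext j k
    by_cases hjk : E j = E k
    · exact conj_energyBasis_apply E σ hjk
    · rw [Matrix.diagonal_apply_ne _ (fun h : j = k => hjk (by rw [h])), Matrix.mul_apply]
      refine Finset.sum_eq_zero fun i _ => ?_
      rw [Matrix.mul_apply, Finset.sum_mul]
      refine Finset.sum_eq_zero fun l _ => ?_
      rw [Matrix.conjTranspose_apply]
      by_cases hl : E l = E j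
      · by_cases hi : E i = E k
        · rw [h l i (by rw [hl, hi]; exact hjk)]
          simp
        · rw [hV0 hi, mul_zero]
      · rw [hV0 hl]
        simp
  rw [← h2]
  calc σ.val = (V * V.conjTranspose) * σ.val * (V * V.conjTranspose) := by rw [h1]; simp
    _ = _ := by simp only [Matrix.mul_assoc]

theorem population_nonneg (E : S → ℝ) (ρ : DensityMatrix S) (i : S) : 0 ≤ population E ρ i :=
  (ρ.posSemidef.submatrix _ : (energyBlock E ρ (E i)).PosSemidef).eigenvalues_nonneg _

theorem sum_population (E : S → ℝ) (ρ : DensityMatrix S) : ∑ i, population E ρ i = 1 := by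
  have hV : energyBasis E ρ * (energyBasis E ρ).conjTranspose = 1 :=
    Matrix.mem_unitaryGroup_iff.mp (energyBasis_mem_unitaryGroup E ρ)
  have h : ∑ i, (population E ρ i : ℂ) = 1 := by
    rw [← ρ.trace_eq_one, ← mul_one ρ.val, ← hV, ← Matrix.mul_assoc, Matrix.trace_mul_comm,
      ← Matrix.mul_assoc]
    refine Finset.sum_congr rfl fun i _ => ?_
    rw [Matrix.diag_apply, conj_energyBasis_apply E ρ rfl, Matrix.diagonal_apply_eq]
  exact_mod_cast h

end EnergyBasis

/-! ### The thermo-majorization curve and its supporting lines -/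

section Curve

variable {S : Type*} [Fintype S] [DecidableEq S]

/-- The weight by which the populations exceed `t` times the Boltzmann weights. -/
def excess (β : ℝ) (E : S → ℝ) (ρ : DensityMatrix S) (t : ℝ) : ℝ :=
  ∑ i, max (population E ρ i - t * Real.exp (-β * E i)) 0

theorem excess_eq_sum_betaOrder (β : ℝ) (E : S → ℝ) (ρ : DensityMatrix S) (t : ℝ) :
    excess β E ρ t = ∑ k, max (population E ρ (betaOrder β E ρ k) -
      t * Real.exp (-β * E (betaOrder β E ρ k))) 0 :=
  ((betaOrder β E ρ).sum_comp fun i =>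
    max (population E ρ i - t * Real.exp (-β * E i)) 0).symm

theorem curve_vertex_eq (β : ℝ) (E : S → ℝ) (ρ : DensityMatrix S) (t : ℝ) (k : ℕ) :
    curveY β E ρ k - t * curveX β E ρ k =
      ∑ i : Fin (Fintype.card S) with i.val < k, (population E ρ (betaOrder β E ρ i) -
        t * Real.exp (-β * E (betaOrder β E ρ i))) := by
  rw [curveY, curveX, Finset.mul_sum, Finset.sum_sub_distrib]

theorem curve_vertex_le_excess (β : ℝ) (E : S → ℝ) (ρ : DensityMatrix S) (t : ℝ) (k : ℕ) :
    curveY β E ρ k - t * curveX β E ρ k ≤ excess β E ρ t := by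
  rw [curve_vertex_eq, excess_eq_sum_betaOrder]
  exact (Finset.sum_le_sum fun i _ => le_max_left _ 0).trans
    (Finset.sum_le_sum_of_subset_of_nonneg (Finset.subset_univ _) fun i _ _ => le_max_right _ _)

/-- The functional is affine on each segment, so it suffices to check the vertices, where discarding
negative terms and adding missing nonnegative ones only increases the sum. -/
theorem sub_mul_le_excess {β : ℝ} {E : S → ℝ} {ρ : DensityMatrix S} {x y : ℝ}
    (h : (x, y) ∈ thermoCurve β E ρ) (t : ℝ) : y - t * x ≤ excess β E ρ t := by
  obtain ⟨k, a, b, ha, hb, hab, hxy⟩ := Set.mem_iUnion.mp h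
  have h0 := curve_vertex_le_excess β E ρ t k
  have h1 := curve_vertex_le_excess β E ρ t (k + 1)
  simp only [Prod.smul_mk, Prod.mk_add_mk, Prod.mk.injEq, smul_eq_mul] at hxy
  obtain ⟨rfl, rfl⟩ := hxy
  calc _ = a * (curveY β E ρ k - t * curveX β E ρ k) +
        b * (curveY β E ρ (k + 1) - t * curveX β E ρ (k + 1)) := by ring
    _ ≤ a * excess β E ρ t + b * excess β E ρ t := by gcongr
    _ = excess β E ρ t := by rw [← add_mul, hab, one_mul]

theorem curve_succ {n : ℕ} (f : Fin n → ℝ) (k : Fin n) :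
    ∑ i : Fin n with i.val < k.val + 1, f i = ∑ i : Fin n with i.val < k.val, f i + f k := by
  have : (Finset.univ.filter fun i : Fin n => i.val < k.val + 1) =
      insert k (Finset.univ.filter fun i : Fin n => i.val < k.val) := by
    ext i
    simp only [Finset.mem_filter, Finset.mem_univ, true_and, Finset.mem_insert, Fin.ext_iff]
    omega
  rw [this, Finset.sum_insert (by simp), add_comm]

/-- Slope of the thermo-majorization curve over the `k`-th level of the `β`-order. -/
def curveSlope (β : ℝ) (E : S → ℝ) (ρ : DensityMatrix S) (k : Fin (Fintype.card S)) : ℝ :=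
  population E ρ (betaOrder β E ρ k) * Real.exp (β * E (betaOrder β E ρ k))

theorem curveSlope_mul_exp (β : ℝ) (E : S → ℝ) (ρ : DensityMatrix S) (k : Fin (Fintype.card S)) :
    curveSlope β E ρ k * Real.exp (-β * E (betaOrder β E ρ k)) =
      population E ρ (betaOrder β E ρ k) := by
  rw [curveSlope, mul_assoc, ← Real.exp_add]
  simp

/-- In the `β`-order the slopes descend, so at this `t` the positive parts keep exactly the levels
before `k`; level `k` itself contributes zero, so the next vertex lies on the same supporting line.
-/
theorem excess_curveSlope (β : ℝ) (E : S → ℝ) (ρ : DensityMatrix S) (k : Fin (Fintype.card S)) :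
    excess β E ρ (curveSlope β E ρ k) =
      curveY β E ρ k - curveSlope β E ρ k * curveX β E ρ k := by
  rw [curve_vertex_eq, excess_eq_sum_betaOrder, Finset.sum_filter]
  refine Finset.sum_congr rfl fun i _ => ?_
  rw [← curveSlope_mul_exp β E ρ i, ← sub_mul]
  have hg := Real.exp_pos (-β * E (betaOrder β E ρ i))
  split_ifs with h
  · have : curveSlope β E ρ k ≤ curveSlope β E ρ i := betaOrder_antitone β E ρ h.le
    exact max_eq_left (mul_nonneg (by linarith) hg.le)
  · have : curveSlope β E ρ i ≤ curveSlope β E ρ k := betaOrder_antitone β E ρ (not_lt.mp h)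
    exact max_eq_right (mul_nonpos_of_nonpos_of_nonneg (by linarith) hg.le)

theorem curveY_succ (β : ℝ) (E : S → ℝ) (ρ : DensityMatrix S) (k : Fin (Fintype.card S)) :
    curveY β E ρ (k + 1) = curveY β E ρ k + population E ρ (betaOrder β E ρ k) :=
  curve_succ _ k

theorem curveX_succ (β : ℝ) (E : S → ℝ) (ρ : DensityMatrix S) (k : Fin (Fintype.card S)) :
    curveX β E ρ (k + 1) = curveX β E ρ k + Real.exp (-β * E (betaOrder β E ρ k)) :=
  curve_succ _ k

theorem excess_curveSlope_succ (β : ℝ) (E : S → ℝ) (ρ : DensityMatrix S)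
    (k : Fin (Fintype.card S)) : excess β E ρ (curveSlope β E ρ k) =
      curveY β E ρ (k + 1) - curveSlope β E ρ k * curveX β E ρ (k + 1) := by
  rw [excess_curveSlope, curveY_succ, curveX_succ, mul_add, curveSlope_mul_exp]
  ring

theorem curveY_mono (β : ℝ) (E : S → ℝ) (ρ : DensityMatrix S) : Monotone (curveY β E ρ) := by
  intro k l hkl
  refine Finset.sum_le_sum_of_subset_of_nonneg ?_ fun i _ _ => population_nonneg _ _ _
  intro i
  simp only [Finset.mem_filter, Finset.mem_univ, true_and]
  omega

theorem curveY_card (β : ℝ) (E : S → ℝ) (ρ : DensityMatrix S) :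
    curveY β E ρ (Fintype.card S) = 1 := by
  rw [curveY, Finset.filter_true_of_mem fun i _ => i.2, ← sum_population E ρ]
  exact (betaOrder β E ρ).sum_comp fun i => population E ρ i

theorem curveY_zero (β : ℝ) (E : S → ℝ) (ρ : DensityMatrix S) : curveY β E ρ 0 = 0 := by
  simp [curveY]

/-- A supporting line of positive slope through a point certifies that no point of the curve at the
same height lies further left. -/
theorem horizontalMonotone_eq {β : ℝ} {E : S → ℝ} {ρ : DensityMatrix S} {x y t : ℝ}
    (h : (x, y) ∈ thermoCurve β E ρ) (ht : 0 < t) (hx : excess β E ρ t = y - t * x) :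
    horizontalMonotone β E ρ y = x := by
  refine IsLeast.csInf_eq ⟨h, fun x' hx' => ?_⟩
  have := sub_mul_le_excess hx' t
  exact le_of_mul_le_mul_left (by linarith : t * x ≤ t * x') ht

theorem curveSlope_pos_of_lt {β : ℝ} {E : S → ℝ} {ρ : DensityMatrix S} {k : Fin (Fintype.card S)}
    (h : curveY β E ρ k < curveY β E ρ (k + 1)) : 0 < curveSlope β E ρ k := by
  rw [curveY_succ] at h
  exact mul_pos (by linarith) (Real.exp_pos _)

/-- Each height in `(0, 1]` is reached by the thermo-majorization curve, with a supporting line of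
positive slope. -/
theorem exists_excess_eq_horizontalMonotone (β : ℝ) (E : S → ℝ) (ρ : DensityMatrix S) {y : ℝ}
    (hy : 0 < y) (hy1 : y ≤ 1) :
    (horizontalMonotone β E ρ y, y) ∈ thermoCurve β E ρ ∧
      ∃ t, 0 < t ∧ excess β E ρ t = y - t * horizontalMonotone β E ρ y := by
  -- The first vertex at height at least `y` ends a strictly rising segment that contains height
  -- `y`; its slope is the required positive `t`.
  have hex : ∃ k, y ≤ curveY β E ρ k := ⟨Fintype.card S, by rwa [curveY_card]⟩
  classical
  obtain ⟨k, hk⟩ : ∃ k, Nat.find hex = k + 1 := Nat.exists_eq_succ_of_ne_zero (by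
    intro h0
    have := Nat.find_spec hex
    rw [h0, curveY_zero] at this
    linarith)
  have hk1 : y ≤ curveY β E ρ (k + 1) := hk ▸ Nat.find_spec hex
  have hk0 : curveY β E ρ k < y := not_le.mp (Nat.find_min hex (by omega))
  have hkn : k < Fintype.card S := by
    have := Nat.find_min' hex (by rwa [curveY_card] : y ≤ curveY β E ρ (Fintype.card S))
    omega
  have ht : 0 < curveSlope β E ρ ⟨k, hkn⟩ := curveSlope_pos_of_lt (hk0.trans_le hk1)
  have hg := curveSlope_mul_exp β E ρ ⟨k, hkn⟩
  have hY := curveY_succ β E ρ ⟨k, hkn⟩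
  have hX := curveX_succ β E ρ ⟨k, hkn⟩
  have hex := excess_curveSlope β E ρ ⟨k, hkn⟩
  simp only at hY hX hex
  set t := curveSlope β E ρ ⟨k, hkn⟩
  have hmem : (curveX β E ρ k + (y - curveY β E ρ k) / t, y) ∈ thermoCurve β E ρ := by
    refine Set.mem_iUnion.mpr ⟨⟨k, hkn⟩, ?_⟩
    have hd : 0 < curveY β E ρ (k + 1) - curveY β E ρ k := by linarith
    rw [segment_eq_image]
    refine ⟨(y - curveY β E ρ k) / (curveY β E ρ (k + 1) - curveY β E ρ k),
      ⟨div_nonneg (by linarith) hd.le, (div_le_one hd).mpr (by linarith)⟩, ?_⟩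
    have h1 : Real.exp (-β * E (betaOrder β E ρ ⟨k, hkn⟩)) =
        (curveY β E ρ (k + 1) - curveY β E ρ k) / t := by
      rw [eq_div_iff ht.ne', hY, ← hg]
      ring
    simp only [Prod.smul_mk, Prod.mk_add_mk, Prod.mk.injEq, smul_eq_mul]
    rw [hX, h1]
    constructor <;> field_simp <;> ring
  have hval : excess β E ρ t = y - t * (curveX β E ρ k + (y - curveY β E ρ k) / t) := by
    rw [hex]
    field_simp
    ring
  rw [horizontalMonotone_eq hmem ht hval]
  exact ⟨hmem, t, ht, hval⟩

/-- Slopes are nonnegative and descend, so vanishing populations come last. A zero at position `k`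
would leave at most `k` nonzero populations. -/
theorem population_pos_of_lt_decoheredRank (β : ℝ) (E : S → ℝ) (ρ : DensityMatrix S)
    {k : Fin (Fintype.card S)} (hk : k.val < decoheredRank E ρ) :
    0 < population E ρ (betaOrder β E ρ k) := by
  refine (population_nonneg _ _ _).lt_of_ne' fun h0 => ?_
  have hz : ∀ l, k ≤ l → population E ρ (betaOrder β E ρ l) = 0 := by
    intro l hl
    have h1 : curveSlope β E ρ l ≤ curveSlope β E ρ k := betaOrder_antitone β E ρ hl
    rw [curveSlope, curveSlope, h0, zero_mul] at h1
    exact le_antisymm (nonpos_of_mul_nonpos_left h1 (Real.exp_pos _)) (population_nonneg _ _ _)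
  have hle : decoheredRank E ρ ≤ k.val := by
    have : Fintype.card {i // population E ρ i ≠ 0} ≤ Fintype.card (Fin k.val) := by
      refine Fintype.card_le_of_injective (fun i => ⟨((betaOrder β E ρ).symm i.1).val, ?_⟩) ?_
      · by_contra hlt
        refine i.2 ?_
        have := hz ((betaOrder β E ρ).symm i.1) (Fin.le_def.mpr (not_lt.mp hlt))
        simpa using this
      · intro i j hij
        simpa [Fin.ext_iff, Subtype.ext_iff, ← Fin.ext_iff] using hij
    simpa [decoheredRank] using this
  omega

theorem decoheredRank_le_card (E : S → ℝ) (ρ : DensityMatrix S) :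
    decoheredRank E ρ ≤ Fintype.card S :=
  Fintype.card_subtype_le _

theorem decoheredRank_pos (E : S → ℝ) (ρ : DensityMatrix S) : 0 < decoheredRank E ρ := by
  refine Fintype.card_pos_iff.mpr ?_
  by_contra h
  have h0 : ∀ i, population E ρ i = 0 := fun i => by_contra fun hi => h ⟨⟨i, hi⟩⟩
  have := sum_population E ρ
  simp [h0] at this

/-- At an elbow, the horizontal monotone is the abscissa of the vertex. -/
theorem horizontalMonotone_curveY (β : ℝ) (E : S → ℝ) (ρ : DensityMatrix S) {k : ℕ}
    (hk : k ∈ Set.Icc 1 (decoheredRank E ρ)) :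
    0 < curveY β E ρ k ∧
      horizontalMonotone β E ρ (curveY β E ρ k) = curveX β E ρ k := by
  obtain ⟨j, rfl⟩ : ∃ j, k = j + 1 := ⟨k - 1, by have := hk.1; omega⟩
  have hj : j < Fintype.card S := lt_of_lt_of_le hk.2 (decoheredRank_le_card E ρ)
  have hp := population_pos_of_lt_decoheredRank β E ρ (k := ⟨j, hj⟩) hk.2
  have hY : curveY β E ρ (j + 1) = _ := curveY_succ β E ρ ⟨j, hj⟩
  have h0 : curveY β E ρ 0 ≤ curveY β E ρ j := curveY_mono β E ρ (Nat.zero_le j)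
  rw [curveY_zero] at h0
  refine ⟨by rw [hY]; exact add_pos_of_nonneg_of_pos h0 hp, ?_⟩
  refine horizontalMonotone_eq (t := curveSlope β E ρ ⟨j, hj⟩) ?_
    (mul_pos hp (Real.exp_pos _)) (excess_curveSlope_succ β E ρ ⟨j, hj⟩)
  exact Set.mem_iUnion.mpr ⟨⟨j, hj⟩, right_mem_segment _ _ _⟩

theorem curveY_le_one (β : ℝ) (E : S → ℝ) (ρ : DensityMatrix S) (k : ℕ) :
    curveY β E ρ k ≤ 1 := by
  rw [← sum_population E ρ, ← (betaOrder β E ρ).sum_comp fun i => population E ρ i]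
  exact Finset.sum_le_sum_of_subset_of_nonneg (Finset.subset_univ _)
    fun i _ _ => population_nonneg _ _ _

/-- For `t ≥ 0`, the excess at `t` vanishes or is attained at an elbow. -/
theorem excess_eq_zero_or_elbow (β : ℝ) (E : S → ℝ) (ρ : DensityMatrix S) {t : ℝ} (ht : 0 ≤ t) :
    excess β E ρ t = 0 ∨ ∃ k ∈ Set.Icc 1 (decoheredRank E ρ),
      excess β E ρ t = curveY β E ρ k - t * curveX β E ρ k := by
  classical
  -- `k` counts the levels of slope above `t`; guarding by `h` admits `k = card S` when all slopes
  -- exceed `t`.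
  have hex : ∃ k, ∀ h : k < Fintype.card S, curveSlope β E ρ ⟨k, h⟩ ≤ t :=
    ⟨Fintype.card S, fun h => absurd h (lt_irrefl _)⟩
  set k := Nat.find hex with hk
  have hlt : ∀ i : Fin (Fintype.card S), i.val < k → t < curveSlope β E ρ i := by
    intro i hi
    obtain ⟨h, hs⟩ := not_forall.mp (Nat.find_min hex hi)
    exact not_le.mp hs
  have hle : ∀ i : Fin (Fintype.card S), k ≤ i.val → curveSlope β E ρ i ≤ t := fun i hi =>
    (betaOrder_antitone β E ρ (Fin.le_def.mpr hi : ⟨k, hi.trans_lt i.2⟩ ≤ i)).trans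
      (Nat.find_spec hex _)
  have hval : excess β E ρ t = curveY β E ρ k - t * curveX β E ρ k := by
    rw [curve_vertex_eq, excess_eq_sum_betaOrder, Finset.sum_filter]
    refine Finset.sum_congr rfl fun i _ => ?_
    rw [← curveSlope_mul_exp β E ρ i, ← sub_mul]
    have hg := Real.exp_pos (-β * E (betaOrder β E ρ i))
    split_ifs with h
    · exact max_eq_left (mul_nonneg (by linarith [hlt i h]) hg.le)
    · exact max_eq_right (mul_nonpos_of_nonpos_of_nonneg (by linarith [hle i (not_lt.mp h)]) hg.le)
  rcases Nat.eq_zero_or_pos k with h0 | h0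
  · left
    rw [hval, h0, curveY_zero]
    simp [curveX]
  · refine Or.inr ⟨k, ⟨h0, ?_⟩, hval⟩
    have hkn : k ≤ Fintype.card S := Nat.find_min' hex fun h => absurd h (lt_irrefl _)
    -- The first `k` slopes exceed `t ≥ 0`, so their populations are nonzero.
    have : Fintype.card (Fin k) ≤ Fintype.card {i // population E ρ i ≠ 0} := by
      refine Fintype.card_le_of_injective
        (fun i => ⟨betaOrder β E ρ (Fin.castLE hkn i), fun h => ?_⟩) fun i j hij => ?_
      · have := hlt (Fin.castLE hkn i) i.2
        rw [curveSlope, h, zero_mul] at this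
        linarith
      · simpa using hij
    simpa [decoheredRank] using this

end Curve

/-! ### Thermal operations in the Heisenberg picture -/

theorem trace_partialTrace {S B : Type*} [Fintype S] [Fintype B] [DecidableEq B]
    (Q : Matrix S S ℂ)
    (M : Matrix (S × B) (S × B) ℂ) :
    (Q * partialTrace M).trace = ((Q ⊗ₖ (1 : Matrix B B ℂ)) * M).trace := by
  simp only [Matrix.trace, Matrix.diag_apply, Matrix.mul_apply, partialTrace, Matrix.of_apply,
    Fintype.sum_prod_type, Matrix.kroneckerMap_apply, Matrix.one_apply, mul_ite, mul_one, mul_zero,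
    ite_mul, zero_mul, Finset.sum_ite_eq, Finset.mem_univ, if_true, Finset.mul_sum]
  exact Finset.sum_congr rfl fun i _ => Finset.sum_comm

theorem posSemidef_sum_smul {ι n : Type*} [Fintype n] (s : Finset ι) (c : ι → ℝ)
    (hc : ∀ i, 0 ≤ c i) (A : ι → Matrix n n ℂ) (hA : ∀ i, (A i).PosSemidef) :
    (∑ i ∈ s, (c i : ℂ) • A i).PosSemidef := by
  classical
  induction s using Finset.induction_on with
  | empty => simpa using Matrix.PosSemidef.zero
  | insert a s ha ih =>
    rw [Finset.sum_insert ha]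
    exact ((hA a).smul (by exact_mod_cast hc a)).add ih

section Monotone

variable {S : Type*} [Fintype S] [DecidableEq S]

theorem commute_hamiltonian_iff (E : S → ℝ) (U : Matrix S S ℂ) :
    Commute U (hamiltonian E) ↔ ∀ i j, E i ≠ E j → U i j = 0 := by
  have h : Commute U (hamiltonian E) ↔ ∀ i j, U i j * (E j : ℂ) = (E i : ℂ) * U i j := by
    rw [commute_iff_eq, ← Matrix.ext_iff]
    simp [hamiltonian, Matrix.mul_diagonal, Matrix.diagonal_mul]
  rw [h]
  refine forall₂_congr fun i j => ⟨fun h hij => ?_, fun h => ?_⟩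
  · have h' : ((E i : ℂ) - E j) * U i j = 0 := by linear_combination -h
    refine (mul_eq_zero.mp h').resolve_left ?_
    exact sub_ne_zero.mpr (by exact_mod_cast hij)
  · by_cases hij : E i = E j
    · rw [hij, mul_comm]
    · simp [h hij]

theorem mul_diagonal_comp_energy {E : S → ℝ} {U : Matrix S S ℂ}
    (h : ∀ i j, E i ≠ E j → U i j = 0) (f : ℝ → ℂ) :
    U * Matrix.diagonal (fun i => f (E i)) = Matrix.diagonal (fun i => f (E i)) * U := by
  ext i j
  rw [Matrix.mul_diagonal, Matrix.diagonal_mul]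
  by_cases hij : E i = E j
  · rw [hij, mul_comm]
  · simp [h i j hij]

/-- The unnormalized Gibbs state. -/
def boltzmann (β : ℝ) (E : S → ℝ) : Matrix S S ℂ :=
  Matrix.diagonal fun i => (Real.exp (-β * E i) : ℂ)

theorem mul_boltzmann {β : ℝ} {E : S → ℝ} {U : Matrix S S ℂ}
    (h : ∀ i j, E i ≠ E j → U i j = 0) : U * boltzmann β E = boltzmann β E * U :=
  mul_diagonal_comp_energy h fun e => (Real.exp (-β * e) : ℂ)

/-- An effect `0 ≤ Q ≤ 1` without coherences between different energies. -/
structure IsBlockEffect (E : S → ℝ) (Q : Matrix S S ℂ) : Prop where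
  posSemidef : Q.PosSemidef
  one_sub_posSemidef : (1 - Q).PosSemidef
  apply_of_ne : ∀ i j, E i ≠ E j → Q i j = 0

/-- Thermal operations in the Heisenberg picture preserve block-diagonal effects and their
Boltzmann weights. -/
theorem exists_pullback_effect {β : ℝ} {E : S → ℝ} {ρ τ : Matrix S S ℂ}
    (hτ : τ ∈ thermalOutputs β E ρ) {Q : Matrix S S ℂ} (hQ : IsBlockEffect E Q) :
    ∃ Q', IsBlockEffect E Q' ∧ (Q' * ρ).trace = (Q * τ).trace ∧
      (Q' * boltzmann β E).trace = (Q * boltzmann β E).trace := by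
  obtain ⟨b, hb, F, U, hU, hcomm, rfl⟩ := hτ
  rw [commute_hamiltonian_iff] at hcomm
  have hU1 : U.conjTranspose * U = 1 := Matrix.mem_unitaryGroup_iff'.mp hU
  have hU2 : U * U.conjTranspose = 1 := Matrix.mem_unitaryGroup_iff.mp hU
  set Z : ℝ := ∑ j, Real.exp (-β * F j) with hZdef
  have hZ : 0 < Z := by
    have : Nonempty (Fin b) := ⟨⟨0, hb⟩⟩
    exact Finset.sum_pos (fun i _ => Real.exp_pos _) Finset.univ_nonempty
  set γ : Fin b → ℝ := fun j => Real.exp (-β * F j) / Z with hγ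
  have hγ0 : ∀ j, 0 ≤ γ j := fun j => (div_pos (Real.exp_pos _) hZ).le
  have hγ1 : ∑ j, (γ j : ℂ) = 1 := by
    have : ∑ j, γ j = 1 := by rw [hγ, ← Finset.sum_div, div_self hZ.ne']
    exact_mod_cast this
  set A := U.conjTranspose * (Q ⊗ₖ (1 : Matrix (Fin b) (Fin b) ℂ)) * U with hA
  have hApos : A.PosSemidef :=
    (hQ.posSemidef.kronecker Matrix.PosSemidef.one).conjTranspose_mul_mul_same U
  have hA1 : (1 - A).PosSemidef := by
    have : 1 - A = U.conjTranspose * ((1 - Q) ⊗ₖ (1 : Matrix (Fin b) (Fin b) ℂ)) * U := by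
      have : (1 - Q) ⊗ₖ (1 : Matrix (Fin b) (Fin b) ℂ) = 1 - Q ⊗ₖ 1 := by
        rw [← Matrix.one_kronecker_one, ← Matrix.ext_iff]
        intro i j
        simp only [Matrix.kroneckerMap_apply, Matrix.sub_apply, sub_mul]
      rw [this, Matrix.mul_sub, Matrix.sub_mul, Matrix.mul_one, hU1, hA]
    rw [this]
    exact (hQ.one_sub_posSemidef.kronecker Matrix.PosSemidef.one).conjTranspose_mul_mul_same U
  have hAblock : ∀ x y, totalEnergy E F x ≠ totalEnergy E F y → A x y = 0 := by
    rw [← commute_hamiltonian_iff]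
    have h1 : Commute U (hamiltonian (totalEnergy E F)) := (commute_hamiltonian_iff _ _).mpr hcomm
    have h2 : Commute U.conjTranspose (hamiltonian (totalEnergy E F)) := by
      rw [commute_hamiltonian_iff]
      intro x y hxy
      rw [Matrix.conjTranspose_apply, hcomm y x hxy.symm, star_zero]
    have h3 : Commute (Q ⊗ₖ (1 : Matrix (Fin b) (Fin b) ℂ)) (hamiltonian (totalEnergy E F)) := by
      rw [commute_hamiltonian_iff]
      intro x y hxy
      rw [Matrix.kroneckerMap_apply, Matrix.one_apply]
      split_ifs with h
      · rw [hQ.apply_of_ne _ _ fun hE => hxy (by rw [totalEnergy, totalEnergy, hE, h]), zero_mul]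
      · rw [mul_zero]
    exact (h2.mul_left h3).mul_left h1
  -- The adjoint of the operation: `Q' = Tr_B [(1 ⊗ γ_B) U† (Q ⊗ 1) U]`.
  refine ⟨∑ j, (γ j : ℂ) • A.submatrix (fun i => (i, j)) (fun i => (i, j)), ⟨?_, ?_, ?_⟩, ?_, ?_⟩
  · exact posSemidef_sum_smul _ γ hγ0 _ fun j => hApos.submatrix _
  · have : (1 : Matrix S S ℂ) - ∑ j, (γ j : ℂ) • A.submatrix (fun i => (i, j)) (fun i => (i, j)) =
        ∑ j, (γ j : ℂ) • (1 - A).submatrix (fun i => (i, j)) (fun i => (i, j)) := by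
      rw [← one_smul ℂ (1 : Matrix S S ℂ), ← hγ1, Finset.sum_smul, ← Finset.sum_sub_distrib]
      refine Finset.sum_congr rfl fun j _ => ?_
      rw [← smul_sub]
      congr 1
      ext i l
      simp [Matrix.one_apply]
    rw [this]
    exact posSemidef_sum_smul _ γ hγ0 _ fun j => hA1.submatrix _
  · intro i j hij
    rw [Matrix.sum_apply]
    refine Finset.sum_eq_zero fun c _ => ?_
    rw [Matrix.smul_apply, Matrix.submatrix_apply, hAblock _ _ (by simpa [totalEnergy] using hij),
      smul_zero]
  · have hl : (A * (ρ ⊗ₖ gibbsState β F)).trace =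
        (Q * partialTrace (U * (ρ ⊗ₖ gibbsState β F) * U.conjTranspose)).trace := by
      rw [trace_partialTrace, hA, Matrix.mul_assoc, Matrix.mul_assoc, Matrix.trace_mul_comm]
      simp only [Matrix.mul_assoc]
    rw [← hl]
    simp only [Matrix.trace, Matrix.diag_apply, Matrix.mul_apply, Matrix.sum_apply,
      Matrix.smul_apply, Matrix.submatrix_apply, smul_eq_mul, gibbsState, Fintype.sum_prod_type,
      Matrix.kroneckerMap_apply, Matrix.diagonal_apply, mul_ite, mul_zero, Finset.sum_ite_eq',
      Finset.mem_univ, if_true, Finset.sum_mul]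
    refine Finset.sum_congr rfl fun i _ => ?_
    refine Finset.sum_congr rfl fun j _ => Finset.sum_congr rfl fun l _ => ?_
    simp only [hγ, hZdef]
    ring
  -- `U` commutes with the total Boltzmann matrix and cancels by cyclicity. The bath then
  -- contributes the factor `Z`, which also normalizes `γ`.
  · have hl : (A * boltzmann β (totalEnergy E F)).trace =
        ((Q ⊗ₖ (1 : Matrix (Fin b) (Fin b) ℂ)) * boltzmann β (totalEnergy E F)).trace := by
      rw [hA, Matrix.mul_assoc, mul_boltzmann hcomm, Matrix.mul_assoc, Matrix.trace_mul_comm,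
        Matrix.mul_assoc, Matrix.mul_assoc, hU2, Matrix.mul_one]
    have hr : ((Q ⊗ₖ (1 : Matrix (Fin b) (Fin b) ℂ)) * boltzmann β (totalEnergy E F)).trace =
        (Z : ℂ) * (Q * boltzmann β E).trace := by
      simp only [Matrix.trace, Matrix.diag_apply, boltzmann, Matrix.mul_diagonal,
        Fintype.sum_prod_type, Matrix.kroneckerMap_apply, Matrix.one_apply_eq, totalEnergy, mul_add,
        Real.exp_add, Finset.mul_sum, mul_one, hZdef]
      refine Finset.sum_congr rfl fun i _ => ?_
      push_cast
      rw [Finset.sum_mul]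
      refine Finset.sum_congr rfl fun j _ => ?_
      ring
    have hZ' : (Z : ℂ) ≠ 0 := by exact_mod_cast hZ.ne'
    refine mul_left_cancel₀ hZ' ?_
    rw [← hr, ← hl]
    simp only [Matrix.trace, Matrix.diag_apply, boltzmann, Matrix.mul_diagonal,
      Fintype.sum_prod_type, totalEnergy, mul_add, Real.exp_add, Matrix.sum_apply,
      Matrix.smul_apply, Matrix.submatrix_apply, smul_eq_mul, Finset.mul_sum, Finset.sum_mul]
    refine Finset.sum_congr rfl fun i _ => Finset.sum_congr rfl fun j _ => ?_
    have : (Real.exp (-β * F j) : ℂ) = Z * (γ j : ℂ) := by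
      rw [hγ]
      push_cast
      field_simp
    push_cast at this ⊢
    rw [this]
    ring

end Monotone

/-! ### Necessity: bounds from block-diagonal effects -/

section Necessity

variable {S : Type*} [Fintype S] [DecidableEq S]

/-- Coherences of `ρ` between different energies only meet vanishing entries of `Q`, so the trace
depends on `ρ_D` alone. -/
theorem trace_mul_eq_sum_population {E : S → ℝ} (ρ : DensityMatrix S) {Q : Matrix S S ℂ}
    (hQ : ∀ i j, E i ≠ E j → Q i j = 0) : (Q * ρ.val).trace =
      ∑ i, ((energyBasis E ρ).conjTranspose * Q * energyBasis E ρ) i i * population E ρ i := by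
  set V := energyBasis E ρ
  have hV : V * V.conjTranspose = 1 :=
    Matrix.mem_unitaryGroup_iff.mp (energyBasis_mem_unitaryGroup E ρ)
  have hV0 : ∀ {i j}, E i ≠ E j → V i j = 0 := energyBasis_apply_of_ne E ρ
  have h : (Q * ρ.val).trace =
      ((V.conjTranspose * Q * V) * (V.conjTranspose * ρ.val * V)).trace := by
    have : (V.conjTranspose * Q * V) * (V.conjTranspose * ρ.val * V) =
        V.conjTranspose * (Q * (V * V.conjTranspose) * ρ.val * V) := by
      simp only [Matrix.mul_assoc]
    rw [this, hV, Matrix.mul_one, Matrix.trace_mul_comm V.conjTranspose, Matrix.mul_assoc, hV, Matrix.mul_one]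
  have hcomm : Commute (V.conjTranspose * Q * V) (hamiltonian E) := by
    refine Commute.mul_left (Commute.mul_left ?_ ?_) ?_ <;> rw [commute_hamiltonian_iff]
    · intro i j hij
      rw [Matrix.conjTranspose_apply, hV0 hij.symm, star_zero]
    · exact hQ
    · exact fun i j => hV0
  rw [commute_hamiltonian_iff] at hcomm
  rw [h]
  refine Finset.sum_congr rfl fun i _ => ?_
  rw [Matrix.diag_apply, Matrix.mul_apply, Finset.sum_eq_single i]
  · rw [conj_energyBasis_apply E ρ rfl, Matrix.diagonal_apply_eq]
  · intro j _ hji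
    by_cases hE : E j = E i
    · rw [conj_energyBasis_apply E ρ hE, Matrix.diagonal_apply_ne _ hji, mul_zero]
    · rw [hcomm i j (Ne.symm hE), zero_mul]
  · simp

theorem trace_mul_boltzmann_eq_sum (β : ℝ) (E : S → ℝ) (ρ : DensityMatrix S) (Q : Matrix S S ℂ) :
    (Q * boltzmann β E).trace =
      ∑ i, ((energyBasis E ρ).conjTranspose * Q * energyBasis E ρ) i i *
        (Real.exp (-β * E i) : ℂ) := by
  set V := energyBasis E ρ
  have hV : V * V.conjTranspose = 1 :=
    Matrix.mem_unitaryGroup_iff.mp (energyBasis_mem_unitaryGroup E ρ)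
  have hVG : V * boltzmann β E = boltzmann β E * V :=
    mul_boltzmann fun i j => energyBasis_apply_of_ne E ρ
  have h : (Q * boltzmann β E).trace = ((V.conjTranspose * Q * V) * boltzmann β E).trace := by
    rw [Matrix.mul_assoc, hVG, Matrix.mul_assoc, Matrix.trace_mul_comm V.conjTranspose, Matrix.mul_assoc,
      Matrix.mul_assoc, hV, Matrix.mul_one]
  rw [h]
  refine Finset.sum_congr rfl fun i _ => ?_
  rw [Matrix.diag_apply, boltzmann, Matrix.mul_diagonal]

/-- Neyman–Pearson: the diagonal entries `q` of the effect lie in `[0, 1]`, hence `q * (p - t * g) ≤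
max (p - t * g) 0` level by level. -/
theorem trace_effect_le {E : S → ℝ} {Q : Matrix S S ℂ} (hQ : IsBlockEffect E Q) (β : ℝ)
    (ρ : DensityMatrix S) (t : ℝ) :
    (Q * ρ.val).trace.re ≤ t * (Q * boltzmann β E).trace.re + excess β E ρ t := by
  have hV : (energyBasis E ρ).conjTranspose * energyBasis E ρ = 1 :=
    Matrix.mem_unitaryGroup_iff'.mp (energyBasis_mem_unitaryGroup E ρ)
  have h0 : ∀ i, 0 ≤ (((energyBasis E ρ).conjTranspose * Q * energyBasis E ρ) i i).re := fun i =>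
    (Complex.le_def.mp
      ((hQ.posSemidef.conjTranspose_mul_mul_same (energyBasis E ρ)).diag_nonneg (i := i))).1
  have h1 : ∀ i, (((energyBasis E ρ).conjTranspose * Q * energyBasis E ρ) i i).re ≤ 1 := fun i => by
    have := (Complex.le_def.mp ((hQ.one_sub_posSemidef.conjTranspose_mul_mul_same
      (energyBasis E ρ)).diag_nonneg (i := i))).1
    rw [Matrix.mul_sub, Matrix.sub_mul, Matrix.mul_one, hV, Matrix.sub_apply,
      Matrix.one_apply_eq] at this
    simpa using this
  rw [trace_mul_eq_sum_population ρ hQ.apply_of_ne, trace_mul_boltzmann_eq_sum β E ρ, excess]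
  simp only [Complex.re_sum, Complex.re_mul_ofReal]
  rw [Finset.mul_sum, ← Finset.sum_add_distrib]
  refine Finset.sum_le_sum fun i _ => ?_
  set q := (((energyBasis E ρ).conjTranspose * Q * energyBasis E ρ) i i).re
  have hm := le_max_left (population E ρ i - t * Real.exp (-β * E i)) 0
  have hm0 := le_max_right (population E ρ i - t * Real.exp (-β * E i)) 0
  nlinarith [h0 i, h1 i, mul_le_mul_of_nonneg_left hm (h0 i), mul_le_mul_of_nonneg_right (h1 i) hm0]

/-- Projection onto the first `k` levels of `ρ_D` in the `β`-order. -/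
def elbowProjection (β : ℝ) (E : S → ℝ) (ρ : DensityMatrix S) (k : ℕ) : Matrix S S ℂ :=
  energyBasis E ρ * Matrix.diagonal (fun i => if ((betaOrder β E ρ).symm i).val < k then 1 else 0) *
    (energyBasis E ρ).conjTranspose

theorem isBlockEffect_elbowProjection (β : ℝ) (E : S → ℝ) (ρ : DensityMatrix S) (k : ℕ) :
    IsBlockEffect E (elbowProjection β E ρ k) := by
  have hV : energyBasis E ρ * (energyBasis E ρ).conjTranspose = 1 :=
    Matrix.mem_unitaryGroup_iff.mp (energyBasis_mem_unitaryGroup E ρ)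
  refine ⟨?_, ?_, ?_⟩
  · refine (Matrix.PosSemidef.diagonal fun i => ?_).mul_mul_conjTranspose_same _
    rw [Pi.zero_apply]
    split_ifs <;> simp
  · have : 1 - elbowProjection β E ρ k = energyBasis E ρ * Matrix.diagonal
        (fun i => 1 - if ((betaOrder β E ρ).symm i).val < k then 1 else 0) *
          (energyBasis E ρ).conjTranspose := by
      have hd : Matrix.diagonal
          (fun i => (1 : ℂ) - if ((betaOrder β E ρ).symm i).val < k then 1 else 0) =
          1 - Matrix.diagonal (fun i => if ((betaOrder β E ρ).symm i).val < k then 1 else 0) := by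
        rw [← Matrix.diagonal_one, Matrix.diagonal_sub]
      rw [hd, Matrix.mul_sub, Matrix.sub_mul, Matrix.mul_one, hV, elbowProjection]
    rw [this]
    refine (Matrix.PosSemidef.diagonal fun i => ?_).mul_mul_conjTranspose_same _
    rw [Pi.zero_apply]
    split_ifs <;> simp
  · rw [← commute_hamiltonian_iff]
    refine Commute.mul_left (Commute.mul_left ?_ ?_) ?_ <;> rw [commute_hamiltonian_iff]
    · exact fun i j => energyBasis_apply_of_ne E ρ
    · exact fun i j hij => Matrix.diagonal_apply_ne _ fun h => hij (by rw [h])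
    · intro i j hij
      rw [Matrix.conjTranspose_apply, energyBasis_apply_of_ne E ρ hij.symm, star_zero]

theorem conj_elbowProjection (β : ℝ) (E : S → ℝ) (ρ : DensityMatrix S) (k : ℕ) :
    (energyBasis E ρ).conjTranspose * elbowProjection β E ρ k * energyBasis E ρ =
      Matrix.diagonal (fun i => if ((betaOrder β E ρ).symm i).val < k then 1 else 0) := by
  have hV : (energyBasis E ρ).conjTranspose * energyBasis E ρ = 1 :=
    Matrix.mem_unitaryGroup_iff'.mp (energyBasis_mem_unitaryGroup E ρ)
  rw [elbowProjection, Matrix.mul_assoc, Matrix.mul_assoc, hV, Matrix.mul_one, ← Matrix.mul_assoc,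
    hV, Matrix.one_mul]

theorem sum_betaOrder_lt (β : ℝ) (E : S → ℝ) (ρ : DensityMatrix S) (k : ℕ) (f : S → ℝ) :
    ∑ i, (if ((betaOrder β E ρ).symm i).val < k then (1 : ℂ) else 0) * (f i : ℂ) =
      ((∑ i : Fin (Fintype.card S) with i.val < k, f (betaOrder β E ρ i) : ℝ) : ℂ) := by
  rw [Finset.sum_filter, ← (betaOrder β E ρ).sum_comp]
  push_cast
  refine Finset.sum_congr rfl fun i _ => ?_
  simp only [Equiv.symm_apply_apply]
  split_ifs <;> simp

theorem trace_elbowProjection_mul (β : ℝ) (E : S → ℝ) (ρ : DensityMatrix S) (k : ℕ) :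
    (elbowProjection β E ρ k * ρ.val).trace = curveY β E ρ k := by
  rw [trace_mul_eq_sum_population ρ (isBlockEffect_elbowProjection β E ρ k).apply_of_ne,
    conj_elbowProjection]
  simp only [Matrix.diagonal_apply_eq]
  exact sum_betaOrder_lt β E ρ k fun i => population E ρ i

theorem trace_elbowProjection_mul_boltzmann (β : ℝ) (E : S → ℝ) (ρ : DensityMatrix S) (k : ℕ) :
    (elbowProjection β E ρ k * boltzmann β E).trace = curveX β E ρ k := by
  rw [trace_mul_boltzmann_eq_sum β E ρ, conj_elbowProjection]
  simp only [Matrix.diagonal_apply_eq]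
  exact sum_betaOrder_lt β E ρ k fun i => Real.exp (-β * E i)

/-- The bound on the trace is a closed condition, so passing from exact outputs to their limits
costs nothing. -/
theorem Transition.trace_effect_le {β : ℝ} {E : S → ℝ} {ρ σ Q : Matrix S S ℂ}
    (h : Transition β E ρ σ) (hQ : IsBlockEffect E Q) {c : ℝ}
    (hc : ∀ Q', IsBlockEffect E Q' →
      (Q' * boltzmann β E).trace = (Q * boltzmann β E).trace → (Q' * ρ).trace.re ≤ c) :
    (Q * σ).trace.re ≤ c := by
  have hclosed : IsClosed {τ : Matrix S S ℂ | (Q * τ).trace.re ≤ c} :=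
    isClosed_le (by fun_prop) continuous_const
  refine closure_minimal (fun τ hτ => ?_) hclosed h
  obtain ⟨Q', hQ', h1, h2⟩ := exists_pullback_effect hτ hQ
  rw [Set.mem_ofPred_eq, ← h1]
  exact hc Q' hQ' h2

theorem IsBlockEffect.kronecker_workState {E : S → ℝ} {Q : Matrix S S ℂ} (hQ : IsBlockEffect E Q)
    (ω : Fin 2 → ℝ) (k : Fin 2) : IsBlockEffect (totalEnergy E ω) (Q ⊗ₖ workState k) := by
  have hw : workState k = Matrix.diagonal fun l => if l = k then 1 else 0 := by
    ext i j
    fin_cases k <;> fin_cases i <;> fin_cases j <;> simp [workState, Matrix.single]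
  have hp : (workState k).PosSemidef := by
    rw [hw]
    refine Matrix.PosSemidef.diagonal fun i => ?_
    rw [Pi.zero_apply]
    split_ifs <;> simp
  have hp1 : (1 - workState k).PosSemidef := by
    rw [hw, ← Matrix.diagonal_one, Matrix.diagonal_sub]
    refine Matrix.PosSemidef.diagonal fun i => ?_
    rw [Pi.zero_apply]
    split_ifs <;> simp
  refine ⟨hQ.posSemidef.kronecker hp, ?_, ?_⟩
  · have : (1 : Matrix (S × Fin 2) (S × Fin 2) ℂ) - Q ⊗ₖ workState k =
        (1 - Q) ⊗ₖ workState k + (1 : Matrix S S ℂ) ⊗ₖ (1 - workState k) := by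
      rw [← Matrix.one_kronecker_one, ← Matrix.ext_iff]
      intro i j
      simp only [Matrix.kroneckerMap_apply, Matrix.sub_apply, Matrix.add_apply]
      ring
    rw [this]
    exact (hQ.one_sub_posSemidef.kronecker hp).add (Matrix.PosSemidef.one.kronecker hp1)
  · intro i j hij
    rw [Matrix.kroneckerMap_apply, hw, Matrix.diagonal_apply]
    split_ifs with h
    · rw [hQ.apply_of_ne _ _ fun hE => hij (by rw [totalEnergy, totalEnergy, hE, h]), zero_mul]
    · rw [mul_zero]
    · rw [mul_zero]

omit [Fintype S] in
theorem IsBlockEffect.submatrix_work {E : S → ℝ} {ω : Fin 2 → ℝ}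
    {Q : Matrix (S × Fin 2) (S × Fin 2) ℂ} (hQ : IsBlockEffect (totalEnergy E ω) Q) (k : Fin 2) :
    IsBlockEffect E (Q.submatrix (fun i => (i, k)) (fun i => (i, k))) := by
  refine ⟨hQ.posSemidef.submatrix _, ?_, ?_⟩
  · convert hQ.one_sub_posSemidef.submatrix (fun i => (i, k)) using 1
    ext i j
    simp [Matrix.one_apply]
  · intro i j hij
    exact hQ.apply_of_ne _ _ (by simpa [totalEnergy] using hij)

omit [DecidableEq S] in
theorem trace_mul_kronecker_workState (Q : Matrix (S × Fin 2) (S × Fin 2) ℂ) (ρ : Matrix S S ℂ)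
    (k : Fin 2) : (Q * (ρ ⊗ₖ workState k)).trace =
      (Q.submatrix (fun i => (i, k)) (fun i => (i, k)) * ρ).trace := by
  simp only [Matrix.trace, Matrix.diag_apply, Matrix.mul_apply, Fintype.sum_prod_type,
    Matrix.kroneckerMap_apply, workState, Matrix.submatrix_apply]
  refine Finset.sum_congr rfl fun i _ => ?_
  rw [Finset.sum_eq_single k]
  · refine Finset.sum_congr rfl fun j _ => ?_
    rw [Finset.sum_eq_single k]
    · simp
    · intro l _ hl
      simp [Matrix.single, hl.symm]
    · simp
  · intro l _ hl
    refine Finset.sum_eq_zero fun j _ => Finset.sum_eq_zero fun m _ => ?_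
    simp [Matrix.single, hl.symm]
  · simp

/-- The other work level contributes a nonnegative amount to the total Boltzmann weight, and
dropping it leaves the block of level `k`. -/
theorem trace_submatrix_boltzmann_le {β : ℝ} {E : S → ℝ} {ω : Fin 2 → ℝ}
    {Q : Matrix (S × Fin 2) (S × Fin 2) ℂ} (hQ : Q.PosSemidef) (k : Fin 2) :
    Real.exp (-β * ω k) *
      (Q.submatrix (fun i => (i, k)) (fun i => (i, k)) * boltzmann β E).trace.re ≤
        (Q * boltzmann β (totalEnergy E ω)).trace.re := by
  simp only [Matrix.trace, Matrix.diag_apply, boltzmann, Matrix.mul_diagonal,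
    Fintype.sum_prod_type, Matrix.submatrix_apply, Complex.re_sum, Complex.re_mul_ofReal,
    Finset.mul_sum]
  refine Finset.sum_le_sum fun i _ => ?_
  have h := Finset.single_le_sum (s := Finset.univ)
    (f := fun l => (Q (i, l) (i, l)).re * Real.exp (-β * totalEnergy E ω (i, l)))
    (fun l _ => mul_nonneg (Complex.le_def.mp (hQ.diag_nonneg (i := (i, l)))).1
      (Real.exp_pos _).le) (Finset.mem_univ k)
  refine le_trans (le_of_eq ?_) h
  simp only [totalEnergy, mul_add, Real.exp_add]
  ring

theorem trace_kronecker_workState_mul_boltzmann (β : ℝ) (E : S → ℝ) (ω : Fin 2 → ℝ)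
    (Q : Matrix S S ℂ) (k : Fin 2) :
    ((Q ⊗ₖ workState k) * boltzmann β (totalEnergy E ω)).trace =
      (Q * boltzmann β E).trace * (Real.exp (-β * ω k) : ℂ) := by
  simp only [Matrix.trace, Matrix.diag_apply, boltzmann, Matrix.mul_diagonal,
    Fintype.sum_prod_type, Matrix.kroneckerMap_apply, workState, Finset.sum_mul]
  refine Finset.sum_congr rfl fun i _ => ?_
  rw [Finset.sum_eq_single k]
  · simp only [totalEnergy, mul_add, Real.exp_add, Matrix.single_apply_same]
    push_cast
    ring
  · intro l _ hl
    simp [Matrix.single, hl.symm]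
  · simp

/-- Thermal operations on system and work system cannot raise the horizontal monotones. -/
theorem Transition.horizontalMonotone_le {β : ℝ} {E : S → ℝ} {ω : Fin 2 → ℝ}
    {ρ σ : DensityMatrix S} {k l : Fin 2}
    (h : Transition β (totalEnergy E ω) (ρ.val ⊗ₖ workState k) (σ.val ⊗ₖ workState l)) {m : ℕ}
    (hm : m ∈ Set.Icc 1 (decoheredRank E σ)) :
    Real.exp (-β * ω k) * horizontalMonotone β E ρ (curveY β E σ m) ≤
      Real.exp (-β * ω l) * horizontalMonotone β E σ (curveY β E σ m) := by
  obtain ⟨hy, hx⟩ := horizontalMonotone_curveY β E σ hm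
  obtain ⟨-, t, ht, hexc⟩ :=
    exists_excess_eq_horizontalMonotone β E ρ hy (curveY_le_one β E σ m)
  have ha := Real.exp_pos (-β * ω k)
  have hQ := (isBlockEffect_elbowProjection β E σ m).kronecker_workState ω l
  -- The pulled-back effect, restricted to work level `k`, has Boltzmann weight at most `curveX m *
  -- exp (-β ω l) / exp (-β ω k)`; the supporting line of slope `t` turns this into the constant
  -- `c`.
  have key := h.trace_effect_le hQ
    (c := t * (curveX β E σ m * Real.exp (-β * ω l) / Real.exp (-β * ω k)) + excess β E ρ t) ?_
  · rw [trace_mul_kronecker_workState] at key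
    have hs : (elbowProjection β E σ m ⊗ₖ workState l).submatrix (fun i => (i, l))
        (fun i => (i, l)) = elbowProjection β E σ m := by
      ext i j
      simp [workState]
    rw [hs, trace_elbowProjection_mul, Complex.ofReal_re, hexc] at key
    rw [hx]
    have h1 : t * horizontalMonotone β E ρ (curveY β E σ m) ≤
        t * (curveX β E σ m * Real.exp (-β * ω l) / Real.exp (-β * ω k)) := by linarith
    have h2 := le_of_mul_le_mul_left h1 ht
    rw [le_div_iff₀ ha] at h2
    linarith
  · intro Q' hQ' hG
    rw [trace_mul_kronecker_workState]
    refine (ThermalWork.trace_effect_le (hQ'.submatrix_work k) β ρ t).trans ?_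
    have h1 := trace_submatrix_boltzmann_le (β := β) (E := E) (ω := ω) hQ'.posSemidef k
    rw [hG, trace_kronecker_workState_mul_boltzmann, trace_elbowProjection_mul_boltzmann,
      ← Complex.ofReal_mul, Complex.ofReal_re] at h1
    gcongr
    rw [le_div_iff₀ ha]
    linarith

end Necessity

/-! ### Weighted majorization and couplings -/

section Majorization

/-- A linear functional that annihilates affine functions and is nonnegative on the functions
`max (x - t) 0` is nonnegative on an interpolant of any convex function at finitely many points. -/
theorem exists_interpolant_nonneg (Λ : (ℝ → ℝ) →ₗ[ℝ] ℝ) (h1 : Λ (fun _ => 1) = 0)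
    (hid : Λ id = 0) (hpos : ∀ t, 0 ≤ Λ fun x => max (x - t) 0) {φ : ℝ → ℝ}
    (hφ : ConvexOn ℝ Set.univ φ) (X : Finset ℝ) :
    ∃ h : ℝ → ℝ, 0 ≤ Λ h ∧ ∀ x ∈ X, h x = φ x := by
  have haff : ∀ p q : ℝ, Λ (fun x => p + q * x) = 0 := by
    intro p q
    have : (fun x : ℝ => p + q * x) = p • (fun _ : ℝ => (1 : ℝ)) + q • (id : ℝ → ℝ) := by
      ext x
      simp
    rw [this, map_add, map_smul, map_smul, h1, hid, smul_zero, smul_zero, add_zero]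
  have hext : ∀ {p q a b : ℝ}, a < b → p + q * a = φ a → p + q * b = φ b → ∀ x, b ≤ x →
      p + q * x ≤ φ x := by
    intro p q a b hab ha hb x hx
    rcases hx.eq_or_lt with rfl | hx
    · exact hb.le
    have := hφ.slope_mono_adjacent (Set.mem_univ a) (Set.mem_univ x) hab hx
    rw [← ha, ← hb] at this
    have hq : (p + q * b - (p + q * a)) / (b - a) = q := by
      rw [div_eq_iff (by linarith)]
      ring
    rw [hq, le_div_iff₀ (by linarith)] at this
    linarith
  -- The induction adds points from left to right. Knowing that `h` is affine and below `φ` to the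
  -- right of all points makes the next change of slope nonnegative.
  suffices H : ∃ h : ℝ → ℝ, 0 ≤ Λ h ∧ (∀ x ∈ X, h x = φ x) ∧ ∃ p q : ℝ, ∀ x, (∀ y ∈ X, y ≤ x) →
      h x = p + q * x ∧ (X.Nonempty → h x ≤ φ x) from
    H.imp fun h hh => ⟨hh.1, hh.2.1⟩
  induction X using Finset.induction_on_max with
  | empty => exact ⟨fun _ => 0, by simpa using (haff 0 0).ge, by simp, 0, 0, by simp⟩
  | insert m X hm ih =>
    rcases X.eq_empty_or_nonempty with rfl | hX
    -- The chord of `φ` over `[m - 1, m]`, continued to the right, stays below `φ` by convexity.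
    · set q := φ m - φ (m - 1)
      refine ⟨fun x => (φ m - q * m) + q * x, (haff _ _).ge, by simp, _, q, fun x hx =>
        ⟨rfl, fun _ => ?_⟩⟩
      refine hext (a := m - 1) (b := m) (by linarith) ?_ (by ring) x (hx m (by simp))
      simp only [q]
      ring
    · obtain ⟨h, hΛ, hX1, p, q, hpq⟩ := ih
      set M := X.max' hX
      have hMX : M ∈ X := X.max'_mem hX
      have hleM : ∀ y ∈ X, y ≤ M := fun y hy => X.le_max' y hy
      have hMm : M < m := hm M hMX
      have hmm := hpq m fun y hy => (hm y hy).le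
      have hMM := hpq M hleM
      -- Bending upwards by `δ` at the last point `M` makes the new function pass through `(m, φ m)`
      -- without changing it on `X`.
      set δ := (φ m - h m) / (m - M)
      have hδ : 0 ≤ δ := div_nonneg (by linarith [hmm.2 hX]) (by linarith)
      have hδm : δ * (m - M) = φ m - h m := div_mul_cancel₀ _ (by linarith)
      have hbeyond : ∀ x, M ≤ x → h x + δ * max (x - M) 0 = (p - δ * M) + (q + δ) * x := by
        intro x hx
        rw [(hpq x fun y hy => (hleM y hy).trans hx).1, max_eq_left (by linarith)]
        ring
      have hm' : h m + δ * max (m - M) 0 = φ m := by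
        rw [max_eq_left (by linarith), hδm]
        ring
      have hX' : ∀ x ∈ X, h x + δ * max (x - M) 0 = φ x := by
        intro x hx
        rw [max_eq_right (by linarith [hleM x hx]), hX1 x hx]
        ring
      refine ⟨fun x => h x + δ * max (x - M) 0, ?_, ?_, p - δ * M, q + δ, fun x hx => ?_⟩
      · have : (fun x => h x + δ * max (x - M) 0) = h + δ • fun x => max (x - M) 0 := rfl
        rw [this, map_add, map_smul]
        exact add_nonneg hΛ (mul_nonneg hδ (hpos M))
      · intro x hx
        rcases Finset.mem_insert.mp hx with rfl | hx
        · exact hm'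
        · exact hX' x hx
      · have hmx : m ≤ x := hx m (by simp)
        refine ⟨hbeyond x (hMm.le.trans hmx), fun _ => ?_⟩
        simp only
        rw [hbeyond x (hMm.le.trans hmx)]
        refine hext hMm ?_ ?_ x hmx
        · rw [← hbeyond M le_rfl, hX' M hMX]
        · rw [← hbeyond m hMm.le, hm']

variable {ι κ : Type*} [Fintype ι] [Fintype κ]

/-- Only finitely many values of `φ` enter. There `φ` agrees with an affine function plus
nonnegative multiples of functions `max (x - t) 0`, for which the inequality is an identity or the
hypothesis. -/
theorem sum_convex_le_of_excess_le {v d : ι → ℝ} {w m : κ → ℝ} (hw : ∀ j, 0 < w j)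
    (hvw : ∑ i, v i = ∑ j, w j) (hvm : ∑ i, v i * d i = ∑ j, m j)
    (h : ∀ t, ∑ j, max (m j - t * w j) 0 ≤ ∑ i, v i * max (d i - t) 0)
    {φ : ℝ → ℝ} (hφ : ConvexOn ℝ Set.univ φ) :
    ∑ j, w j * φ (m j / w j) ≤ ∑ i, v i * φ (d i) := by
  classical
  let Λ : (ℝ → ℝ) →ₗ[ℝ] ℝ := ∑ i, v i • LinearMap.proj (d i) - ∑ j, w j • LinearMap.proj (m j / w j)
  have hΛ : ∀ f, Λ f = ∑ i, v i * f (d i) - ∑ j, w j * f (m j / w j) := by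
    intro f
    simp [Λ]
  have hid : Λ id = 0 := by
    rw [hΛ]
    simp only [id]
    rw [hvm, Finset.sum_congr rfl fun j _ => mul_div_cancel₀ (m j) (hw j).ne', sub_self]
  have hpos : ∀ t, 0 ≤ Λ fun x => max (x - t) 0 := by
    intro t
    rw [hΛ, sub_nonneg]
    refine le_trans (le_of_eq (Finset.sum_congr rfl fun j _ => ?_)) (h t)
    rw [mul_max_of_nonneg _ _ (hw j).le, mul_zero, mul_sub, mul_div_cancel₀ _ (hw j).ne', mul_comm t]
  obtain ⟨g, hg, hgX⟩ := exists_interpolant_nonneg Λ (by simp [hΛ, hvw]) hid hpos hφ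
    (Finset.univ.image d ∪ Finset.univ.image fun j => m j / w j)
  have h1 : ∀ i, g (d i) = φ (d i) := fun i => hgX _ (by simp)
  have h2 : ∀ j, g (m j / w j) = φ (m j / w j) := fun j => hgX _ (by simp)
  rw [hΛ] at hg
  simp only [h1, h2] at hg
  linarith

/-- Majorization relative to weights is implemented by a coupling of the weights. -/
theorem exists_coupling_of_excess_le [Nonempty κ] {v d : ι → ℝ} {w m : κ → ℝ} (hv : ∀ i, 0 ≤ v i)
    (hw : ∀ j, 0 < w j)
    (hvw : ∑ i, v i = ∑ j, w j) (hvm : ∑ i, v i * d i = ∑ j, m j)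
    (h : ∀ t, ∑ j, max (m j - t * w j) 0 ≤ ∑ i, v i * max (d i - t) 0) :
    ∃ K : ι → κ → ℝ, (∀ i j, 0 ≤ K i j) ∧ (∀ i, ∑ j, K i j = v i) ∧ (∀ j, ∑ i, K i j = w j) ∧
      ∀ j, ∑ i, K i j * d i = m j := by
  classical
  set s := ∑ j, w j with hs
  have hs0 : 0 < s := Finset.sum_pos (fun j _ => hw j) Finset.univ_nonempty
  -- A coupling exists iff the prescribed marginals and moments, divided by the total mass `s`, lie
  -- in the compact convex image of the simplex under `T`.
  let T : (ι × κ → ℝ) →ₗ[ℝ] (ι → ℝ) × (κ → ℝ) × (κ → ℝ) :=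
    { toFun := fun K => (fun i => ∑ j, K (i, j), fun j => ∑ i, K (i, j),
        fun j => ∑ i, K (i, j) * d i)
      map_add' := fun K K' => by
        ext <;> simp [Finset.sum_add_distrib, add_mul]
      map_smul' := fun c K => by
        ext <;> simp [Finset.mul_sum, mul_assoc] }
  by_cases hmem : (s⁻¹ • v, s⁻¹ • w, s⁻¹ • m) ∈ T '' stdSimplex ℝ (ι × κ)
  · obtain ⟨K, hK, hT⟩ := hmem
    have e1 : ∀ i, ∑ j, K (i, j) = s⁻¹ * v i := fun i => congrFun (congrArg Prod.fst hT) i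
    have e2 : ∀ j, ∑ i, K (i, j) = s⁻¹ * w j := fun j =>
      congrFun (congrArg (fun z => z.2.1) hT) j
    have e3 : ∀ j, ∑ i, K (i, j) * d i = s⁻¹ * m j := fun j =>
      congrFun (congrArg (fun z => z.2.2) hT) j
    refine ⟨fun i j => s * K (i, j), fun i j => mul_nonneg hs0.le (hK.1 _), fun i => ?_,
      fun j => ?_, fun j => ?_⟩
    · rw [← Finset.mul_sum, e1, mul_inv_cancel_left₀ hs0.ne']
    · rw [← Finset.mul_sum, e2, mul_inv_cancel_left₀ hs0.ne']
    · simp only [mul_assoc]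
      rw [← Finset.mul_sum, e3, mul_inv_cancel_left₀ hs0.ne']
  exfalso
  have hT : Continuous T := T.continuous_of_finiteDimensional
  obtain ⟨f, u, hfx, hfT⟩ := geometric_hahn_banach_point_closed
    ((convex_stdSimplex ℝ (ι × κ)).linear_image T)
    ((isCompact_stdSimplex ℝ (ι × κ)).image hT).isClosed hmem
  set A : ι → ℝ := fun i => f (Pi.single i 1, 0, 0) with hA
  set B : κ → ℝ := fun j => f (0, Pi.single j 1, 0) with hB
  set C : κ → ℝ := fun j => f (0, 0, Pi.single j 1) with hC
  have hf : ∀ a b c, f (a, b, c) = ∑ i, a i * A i + ∑ j, b j * B j + ∑ j, c j * C j := by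
    intro a b c
    have e : (a, b, c) = ∑ i, a i • ((Pi.single i 1, 0, 0) : (ι → ℝ) × (κ → ℝ) × (κ → ℝ)) +
        ∑ j, b j • ((0, Pi.single j 1, 0) : (ι → ℝ) × (κ → ℝ) × (κ → ℝ)) +
        ∑ j, c j • ((0, 0, Pi.single j 1) : (ι → ℝ) × (κ → ℝ) × (κ → ℝ)) := by
      ext l <;> simp [Prod.fst_sum, Prod.snd_sum, Finset.sum_apply, Pi.single_apply]
    rw [e]
    simp only [map_add, map_sum, map_smul, smul_eq_mul, hA, hB, hC]
  have hvert : ∀ i j, u < A i + B j + C j * d i := by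
    intro i j
    have := hfT _ ⟨Pi.single (i, j) 1, single_mem_stdSimplex ℝ (i, j), rfl⟩
    have e : T (Pi.single (i, j) 1) = (Pi.single i 1, Pi.single j 1, d i • Pi.single j 1) := by
      ext l <;> simp [T, Pi.single_apply, Prod.ext_iff, ite_and]
    rw [e, hf] at this
    simpa [Pi.single_apply, mul_comm] using this
  -- The separating functional yields an envelope of lines `φ` with `φ (d i) ≤ A i`. The convex
  -- inequality for `φ` then gives at least `u` at the separated point, a contradiction.
  have hφ : ConvexOn ℝ Set.univ
      (Finset.univ.sup' Finset.univ_nonempty fun j => fun x : ℝ => u - B j - C j * x) := by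
    refine Finset.sup'_induction (p := ConvexOn ℝ Set.univ) _ _ (fun a ha b hb => ha.sup hb)
      fun j _ => ⟨convex_univ, fun x _ y _ a b _ _ hab => le_of_eq ?_⟩
    simp only [smul_eq_mul]
    linear_combination (-(u - B j)) * hab
  set φ := Finset.univ.sup' Finset.univ_nonempty fun j => fun x : ℝ => u - B j - C j * x
  have hφle : ∀ j x, u - B j - C j * x ≤ φ x := by
    intro j x
    exact (Finset.le_sup' (fun j => fun x : ℝ => u - B j - C j * x) (Finset.mem_univ j)) x
  have hφA : ∀ i, φ (d i) ≤ A i := by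
    intro i
    simp only [φ, Finset.sup'_apply]
    exact Finset.sup'_le _ _ fun j _ => by linarith [hvert i j]
  have key := sum_convex_le_of_excess_le hw hvw hvm h hφ
  have k1 : ∑ i, v i * φ (d i) ≤ ∑ i, v i * A i :=
    Finset.sum_le_sum fun i _ => mul_le_mul_of_nonneg_left (hφA i) (hv i)
  have k2 : ∑ j, (w j * u - w j * B j - m j * C j) ≤ ∑ j, w j * φ (m j / w j) := by
    refine Finset.sum_le_sum fun j _ => ?_
    have := mul_le_mul_of_nonneg_left (hφle j (m j / w j)) (hw j).le
    refine le_trans (le_of_eq ?_) this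
    have hwj := (hw j).ne'
    field_simp
  rw [hf] at hfx
  simp only [Pi.smul_apply, smul_eq_mul, mul_assoc, ← Finset.mul_sum] at hfx
  rw [← mul_add, ← mul_add, inv_mul_lt_iff₀ hs0] at hfx
  rw [Finset.sum_sub_distrib, Finset.sum_sub_distrib, ← Finset.sum_mul] at k2
  linarith

end Majorization

/-! ### Thermal operations from energy-preserving permutations -/

section Permutations

variable {S : Type*} [Fintype S] [DecidableEq S]

/-- A bath may be indexed by any finite type. -/
theorem partialTrace_mem_thermalOutputs {B : Type*} [Fintype B] [DecidableEq B] [Nonempty B]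
    {β : ℝ} {E : S → ℝ} (ρ : Matrix S S ℂ) (F : B → ℝ) {U : Matrix (S × B) (S × B) ℂ}
    (hU : U ∈ Matrix.unitaryGroup (S × B) ℂ)
    (hcomm : ∀ x y, totalEnergy E F x ≠ totalEnergy E F y → U x y = 0) :
    partialTrace (U * (ρ ⊗ₖ gibbsState β F) * U.conjTranspose) ∈ thermalOutputs β E ρ := by
  let e : Fin (Fintype.card B) ≃ B := (Fintype.equivFin B).symm
  let e' : S × Fin (Fintype.card B) ≃ S × B := Equiv.prodCongr (Equiv.refl S) e
  refine ⟨Fintype.card B, Fintype.card_pos, F ∘ e, U.submatrix e' e', ?_, ?_, ?_⟩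
  · rw [Matrix.mem_unitaryGroup_iff] at hU ⊢
    rw [Matrix.star_eq_conjTranspose, Matrix.conjTranspose_submatrix,
      Matrix.submatrix_mul_equiv, ← Matrix.star_eq_conjTranspose, hU, Matrix.submatrix_one_equiv]
  · rw [commute_hamiltonian_iff]
    exact fun x y hxy => hcomm (e' x) (e' y) hxy
  · have hγ : ρ ⊗ₖ gibbsState β (F ∘ e) = (ρ ⊗ₖ gibbsState β F).submatrix e' e' := by
      ext x y
      have hZ : ∑ j, Real.exp (-β * F (e j)) = ∑ j, Real.exp (-β * F j) :=
        e.sum_comp fun j => Real.exp (-β * F j)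
      simp only [Matrix.kroneckerMap_apply, Matrix.submatrix_apply, gibbsState,
        Matrix.diagonal_apply, e', Equiv.prodCongr_apply, Prod.map, Equiv.refl_apply,
        e.injective.eq_iff, Function.comp_apply, hZ]
    rw [hγ, Matrix.conjTranspose_submatrix, Matrix.submatrix_mul_equiv,
      Matrix.submatrix_mul_equiv]
    ext i j
    simp only [partialTrace, Matrix.of_apply, Matrix.submatrix_apply, e', Equiv.prodCongr_apply,
      Prod.map, Equiv.refl_apply]
    exact (e.sum_comp fun b => (U * (ρ ⊗ₖ gibbsState β F) * U.conjTranspose) (i, b) (j, b)).symm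

omit [DecidableEq S] in
theorem partialTrace_kronecker_one_mul_mul {B : Type*} [Fintype B] [DecidableEq B]
    (V W : Matrix S S ℂ) (M : Matrix (S × B) (S × B) ℂ) :
    partialTrace ((V ⊗ₖ (1 : Matrix B B ℂ)) * M * (W ⊗ₖ (1 : Matrix B B ℂ))) =
      V * partialTrace M * W := by
  ext i j
  simp only [partialTrace, Matrix.of_apply, Matrix.mul_apply, Fintype.sum_prod_type,
    Matrix.kroneckerMap_apply, Matrix.one_apply, mul_ite, mul_one, mul_zero,
    ite_mul, zero_mul, Finset.sum_ite_eq, Finset.sum_ite_eq', Finset.mem_univ, if_true,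
    Finset.mul_sum, Finset.sum_mul]
  rw [Finset.sum_comm]
  refine Finset.sum_congr rfl fun k _ => ?_
  rw [Finset.sum_comm]

/-- Unitaries of the system that commute with its Hamiltonian may precede and follow a thermal
operation. -/
theorem conj_mem_thermalOutputs {β : ℝ} {E : S → ℝ} {ρ τ V W : Matrix S S ℂ}
    (hV : V ∈ Matrix.unitaryGroup S ℂ) (hV0 : ∀ i j, E i ≠ E j → V i j = 0)
    (hW : W ∈ Matrix.unitaryGroup S ℂ) (hW0 : ∀ i j, E i ≠ E j → W i j = 0)
    (hτ : τ ∈ thermalOutputs β E (V.conjTranspose * ρ * V)) :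
    W * τ * W.conjTranspose ∈ thermalOutputs β E ρ := by
  obtain ⟨b, hb, F, U, hU, hcomm, rfl⟩ := hτ
  have hK : ∀ A C : Matrix S S ℂ, (A ⊗ₖ (1 : Matrix (Fin b) (Fin b) ℂ)) * (C ⊗ₖ 1) = (A * C) ⊗ₖ 1 :=
    fun A C => by rw [← Matrix.mul_kronecker_mul, Matrix.one_mul]
  have hKH : ∀ A : Matrix S S ℂ, (A ⊗ₖ (1 : Matrix (Fin b) (Fin b) ℂ)).conjTranspose =
      A.conjTranspose ⊗ₖ 1 := fun A => by
    rw [Matrix.conjTranspose_kronecker, Matrix.conjTranspose_one]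
  have hKU : ∀ A ∈ Matrix.unitaryGroup S ℂ,
      A ⊗ₖ (1 : Matrix (Fin b) (Fin b) ℂ) ∈ Matrix.unitaryGroup (S × Fin b) ℂ := fun A hA => by
    rw [Matrix.mem_unitaryGroup_iff, Matrix.star_eq_conjTranspose] at hA ⊢
    rw [hKH, hK, hA, Matrix.one_kronecker_one]
  have hVH : V.conjTranspose ∈ Matrix.unitaryGroup S ℂ := Unitary.star_mem hV
  have hKc : ∀ A : Matrix S S ℂ, (∀ i j, E i ≠ E j → A i j = 0) →
      Commute (A ⊗ₖ (1 : Matrix (Fin b) (Fin b) ℂ)) (hamiltonian (totalEnergy E F)) := by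
    intro A hA
    rw [commute_hamiltonian_iff]
    intro x y hxy
    rw [Matrix.kroneckerMap_apply, Matrix.one_apply]
    split_ifs with h
    · rw [hA _ _ fun hE => hxy (by rw [totalEnergy, totalEnergy, hE, h]), zero_mul]
    · rw [mul_zero]
  refine ⟨b, hb, F, (W ⊗ₖ 1) * U * (V.conjTranspose ⊗ₖ 1),
    mul_mem (mul_mem (hKU W hW) hU) (hKU _ hVH), ((hKc W hW0).mul_left hcomm).mul_left
      (hKc _ fun i j hij => by rw [Matrix.conjTranspose_apply, hV0 j i hij.symm, star_zero]), ?_⟩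
  rw [← partialTrace_kronecker_one_mul_mul]
  congr 1
  have hρ : (V.conjTranspose * ρ * V) ⊗ₖ gibbsState β F =
      (V.conjTranspose ⊗ₖ 1) * (ρ ⊗ₖ gibbsState β F) * (V ⊗ₖ 1) := by
    rw [← Matrix.mul_kronecker_mul, ← Matrix.mul_kronecker_mul, Matrix.one_mul, Matrix.mul_one]
  rw [hρ, Matrix.conjTranspose_mul, Matrix.conjTranspose_mul, hKH, hKH,
    Matrix.conjTranspose_conjTranspose]
  simp only [Matrix.mul_assoc]

/-- For `i ≠ j`, flipping the `i`-th sign is a bijection of the sign patterns that negates the sum.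
-/
theorem sum_sign_mul_sign (i j : S) :
    ∑ s : S → ℤˣ, (((s i : ℤ) : ℂ) * ((s j : ℤ) : ℂ)) =
      if i = j then (Fintype.card (S → ℤˣ) : ℂ) else 0 := by
  split_ifs with h
  · subst h
    have : ∀ s : S → ℤˣ, (((s i : ℤ) : ℂ) * ((s i : ℤ) : ℂ)) = 1 := fun s => by
      rw [← Int.cast_mul, ← Units.val_mul, Int.units_mul_self]
      simp
    simp [this]
  · let u : S → ℤˣ := Pi.mulSingle i (-1)
    have hsum := Equiv.sum_comp (Equiv.mulLeft u)
      fun s : S → ℤˣ => (((s i : ℤ) : ℂ) * ((s j : ℤ) : ℂ))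
    have hneg : ∀ s : S → ℤˣ, ((((Equiv.mulLeft u s) i : ℤ) : ℂ) *
        (((Equiv.mulLeft u s) j : ℤ) : ℂ)) =
        -(((s i : ℤ) : ℂ) * ((s j : ℤ) : ℂ)) := by
      intro s
      simp [u, Pi.mulSingle_eq_of_ne (Ne.symm h)]
    rw [Finset.sum_congr rfl fun s _ => hneg s, Finset.sum_neg_distrib] at hsum
    exact self_eq_neg.mp hsum.symm

theorem conj_signedPerm_apply {n : Type*} [Fintype n] [DecidableEq n] (π : Equiv.Perm n)
    (c : n → ℂ) (X : Matrix n n ℂ) (x y : n) :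
    ((Matrix.diagonal c).submatrix π.symm id * X *
      ((Matrix.diagonal c).submatrix π.symm id).conjTranspose) x y =
        c (π.symm x) * X (π.symm x) (π.symm y) * star (c (π.symm y)) := by
  have h : ∀ x z, ((Matrix.diagonal c).submatrix π.symm id) x z =
      if π.symm x = z then c (π.symm x) else 0 := fun x z => by
    rw [Matrix.submatrix_apply, id, Matrix.diagonal_apply]
  simp only [Matrix.mul_apply, Matrix.conjTranspose_apply, h, ite_mul, zero_mul,
    Finset.sum_ite_eq, Finset.mem_univ, if_true, apply_ite (star : ℂ → ℂ), star_zero, mul_ite,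
    mul_zero]

/-- Thermal operations remove the coherences and permute the energy levels of system and bath. -/
theorem diagonal_perm_mem_thermalOutputs {B : Type*} [Fintype B] [DecidableEq B] [Nonempty B]
    (β : ℝ) {E : S → ℝ} (ρ : Matrix S S ℂ) (F : B → ℝ) (π : Equiv.Perm (S × B))
    (hπ : ∀ x, totalEnergy E F (π x) = totalEnergy E F x) :
    Matrix.diagonal (fun j => ∑ b, ρ (π.symm (j, b)).1 (π.symm (j, b)).1 *
      ((Real.exp (-β * F (π.symm (j, b)).2) / ∑ b, Real.exp (-β * F b) : ℝ) : ℂ)) ∈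
        thermalOutputs β E ρ := by
  -- The bath is enlarged by a register of sign patterns at no energy cost, hence uniformly
  -- distributed; the unitary multiplies system level `i` by its sign before permuting.
  let F' : B × (S → ℤˣ) → ℝ := fun b => F b.1
  let a : S × (B × (S → ℤˣ)) ≃ (S × B) × (S → ℤˣ) := (Equiv.prodAssoc _ _ _).symm
  let π' : Equiv.Perm (S × (B × (S → ℤˣ))) :=
    (a.trans (Equiv.prodCongr π (Equiv.refl _))).trans a.symm
  have hπ' : ∀ i b s, π'.symm (i, (b, s)) = ((π.symm (i, b)).1, ((π.symm (i, b)).2, s)) :=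
    fun i b s => rfl
  let c : S × (B × (S → ℤˣ)) → ℂ := fun x => ((x.2.2 x.1 : ℤ) : ℂ)
  have hc : ∀ x, c x * star (c x) = 1 := fun x => by
    simp only [c]
    rcases Int.units_eq_one_or (x.2.2 x.1) with h | h <;> simp [h]
  set U := (Matrix.diagonal c).submatrix π'.symm id with hUdef
  have hU : U ∈ Matrix.unitaryGroup (S × (B × (S → ℤˣ))) ℂ := by
    rw [Matrix.mem_unitaryGroup_iff, Matrix.star_eq_conjTranspose]
    ext x y
    have := conj_signedPerm_apply π' c 1 x y
    rw [Matrix.mul_one] at this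
    rw [this]
    by_cases h : x = y
    · rw [h, Matrix.one_apply_eq, Matrix.one_apply_eq, mul_one, hc]
    · rw [Matrix.one_apply_ne h, Matrix.one_apply_ne (π'.symm.injective.ne h), mul_zero, zero_mul]
  have hcomm : ∀ x y, totalEnergy E F' x ≠ totalEnergy E F' y → U x y = 0 := by
    intro x y hxy
    rw [hUdef, Matrix.submatrix_apply, id]
    refine Matrix.diagonal_apply_ne _ fun h => hxy ?_
    rw [← h]
    obtain ⟨i, b, s⟩ := x
    rw [hπ']
    have := hπ (π.symm (i, b))
    rw [Equiv.apply_symm_apply] at this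
    exact this
  convert partialTrace_mem_thermalOutputs (β := β) ρ F' hU hcomm using 1
  have hN : (Fintype.card (S → ℤˣ) : ℂ) ≠ 0 := by exact_mod_cast Fintype.card_ne_zero
  have hZ : ∑ b, Real.exp (-β * F' b) = (∑ b, Real.exp (-β * F b)) * Fintype.card (S → ℤˣ) := by
    rw [Fintype.sum_prod_type, Finset.sum_mul]
    refine Finset.sum_congr rfl fun b _ => ?_
    simp [F', mul_comm]
  ext j l
  simp only [partialTrace, Matrix.of_apply, Fintype.sum_prod_type]
  rw [Matrix.diagonal_apply]
  have hterm : ∀ b : B, ∑ s : S → ℤˣ, (U * (ρ ⊗ₖ gibbsState β F') * U.conjTranspose)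
      (j, (b, s)) (l, (b, s)) = if j = l then ρ (π.symm (j, b)).1 (π.symm (j, b)).1 *
      ((Real.exp (-β * F (π.symm (j, b)).2) / ∑ b, Real.exp (-β * F b) : ℝ) : ℂ) else 0 := by
    intro b
    have hs : ∀ s : S → ℤˣ, (U * (ρ ⊗ₖ gibbsState β F') * U.conjTranspose)
        (j, (b, s)) (l, (b, s)) =
        (((s (π.symm (j, b)).1 : ℤ) : ℂ) * ((s (π.symm (l, b)).1 : ℤ) : ℂ)) *
        (ρ (π.symm (j, b)).1 (π.symm (l, b)).1 *
          if (π.symm (j, b)).2 = (π.symm (l, b)).2 then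
            ((Real.exp (-β * F (π.symm (j, b)).2) / ((∑ b, Real.exp (-β * F b)) *
              Fintype.card (S → ℤˣ)) : ℝ) : ℂ) else 0) := by
      intro s
      rw [hUdef, conj_signedPerm_apply, hπ', hπ', Matrix.kroneckerMap_apply, gibbsState, hZ,
        Matrix.diagonal_apply]
      simp only [c, F', Prod.mk.injEq, and_true, star_intCast]
      ring
    rw [Finset.sum_congr rfl fun s _ => hs s, ← Finset.sum_mul, sum_sign_mul_sign]
    by_cases hjl : j = l
    · subst hjl
      simp only [if_true]
      push_cast
      field_simp
    · rw [if_neg hjl]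
      -- For `j ≠ l` the preimages differ: either in the bath, where `γ_B` is diagonal, or in the
      -- system, where the signs average to zero.
      by_cases h1 : (π.symm (j, b)).1 = (π.symm (l, b)).1
      · rw [if_neg fun h2 => hjl (congrArg Prod.fst (π.symm.injective (Prod.ext h1 h2)))]
        simp
      · rw [if_neg h1, zero_mul]
  rw [Finset.sum_congr rfl fun b _ => hterm b]
  split_ifs with h
  · rfl
  · simp

end Permutations

/-! ### The lattice bath realizing a coupling -/

section Bath

/-- In each finite fibre of `lab`, a bijection between two subsets extends to a permutation of the
fibre. -/
theorem exists_perm_extending {T X L : Type*} [Finite X] (lab : X → L) {a b : T → X}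
    (ha : Function.Injective a) (hb : Function.Injective b) (hab : ∀ t, lab (a t) = lab (b t)) :
    ∃ π : Equiv.Perm X, (∀ t, π (a t) = b t) ∧ ∀ x, lab (π x) = lab x := by
  classical
  have hfib : ∀ c : L, ∃ e : {x // lab x = c} ≃ {x // lab x = c},
      ∀ t (h : lab (a t) = c), (e ⟨a t, h⟩ : X) = b t := by
    intro c
    let a' : {t // lab (a t) = c} → {x // lab x = c} := fun t => ⟨a t, t.2⟩
    let b' : {t // lab (a t) = c} → {x // lab x = c} := fun t => ⟨b t, (hab t) ▸ t.2⟩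
    have ha' : Function.Injective a' := fun s t h => Subtype.ext (ha (congrArg Subtype.val h))
    have hb' : Function.Injective b' := fun s t h => Subtype.ext (hb (congrArg Subtype.val h))
    let e := (Equiv.ofInjective a' ha').symm.trans (Equiv.ofInjective b' hb')
    refine ⟨Equiv.extendSubtype (p := (· ∈ Set.range a')) (q := (· ∈ Set.range b')) e,
      fun t h => ?_⟩
    have hmem : (⟨a t, h⟩ : {x // lab x = c}) ∈ Set.range a' := ⟨⟨t, h⟩, rfl⟩
    rw [Equiv.extendSubtype_apply_of_mem _ _ hmem]
    have : (Equiv.ofInjective a' ha').symm ⟨⟨a t, h⟩, hmem⟩ = ⟨t, h⟩ :=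
      Equiv.ofInjective_symm_apply ha' ⟨t, h⟩
    simp only [e, Equiv.trans_apply, this]
    rfl
  choose e he using hfib
  refine ⟨Equiv.ofFiberEquiv (f := lab) (g := lab) e, fun t => ?_, fun x =>
    Equiv.ofFiberEquiv_map _ _⟩
  exact he _ t rfl

variable {S : Type*} [Fintype S] [DecidableEq S]

/-- Energy of `k l` quanta of size `E l` for each `l`. -/
def latticeEnergy (E : S → ℝ) {L : ℕ} (k : S → Fin L) : ℝ :=
  ∑ l, (k l : ℕ) * E l

/-- Removal of one quantum of size `E i` from `K + 1`. -/
def removeQuantum {N : ℕ} (K : S → Fin N) (i : S) : S → Fin (N + 1) :=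
  fun l => if l = i then (K l).castSucc else (K l).succ

omit [Fintype S] in
theorem removeQuantum_injective {N : ℕ} (i : S) :
    Function.Injective fun K : S → Fin N => removeQuantum K i := by
  intro K K' h
  ext l
  have := congrArg Fin.val (congrFun h l)
  simp only [removeQuantum] at this
  split_ifs at this <;> simpa using this

/-- The right side does not depend on `i`: for fixed `K`, the levels `i`, each paired with its own
bath point, share one total energy and may be exchanged. -/
theorem latticeEnergy_removeQuantum (E : S → ℝ) {N : ℕ} (K : S → Fin N) (i : S) :
    E i + latticeEnergy E (removeQuantum K i) = latticeEnergy E (fun l => (K l).succ) := by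
  rw [latticeEnergy, latticeEnergy, ← Finset.add_sum_erase _ _ (Finset.mem_univ i),
    ← Finset.add_sum_erase _ _ (Finset.mem_univ i), ← add_assoc]
  congr 1
  · simp only [removeQuantum, if_true, Fin.val_castSucc, Fin.val_succ]
    push_cast
    ring
  · refine Finset.sum_congr rfl fun l hl => ?_
    rw [removeQuantum, if_neg (Finset.ne_of_mem_erase hl)]

/-- The rounded-down parts never exceed the rounded-down whole. -/
theorem exists_embedding_fin {κ : Type*} [Fintype κ] {x G : ℝ} (hx : 0 ≤ x) {c : κ → ℝ}
    (hc : ∀ j, 0 ≤ c j) (hG : x * ∑ j, c j = G) :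
    Nonempty ((Σ j, Fin ⌊x * c j⌋₊) ↪ Fin ⌊G⌋₊) := by
  refine Function.Embedding.nonempty_of_card_le ?_
  rw [Fintype.card_sigma, Fintype.card_fin]
  refine Nat.le_floor ?_
  rw [← hG, Finset.mul_sum]
  push_cast
  refine Finset.sum_le_sum fun j _ => ?_
  rw [Fintype.card_fin]
  exact Nat.floor_le (mul_nonneg hx (hc j))

/-- A bath whose levels form a large box of a lattice, with degeneracies proportional to the inverse
Boltzmann weights up to rounding, implements a coupling of the Boltzmann weights approximately. -/
theorem exists_bath_perm (β : ℝ) (E : S → ℝ) {c : S → S → ℝ} (hc : ∀ i j, 0 ≤ c i j)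
    (hrow : ∀ i, ∑ j, c i j = Real.exp (-β * E i)) (hcol : ∀ j, ∑ i, c i j = Real.exp (-β * E j))
    {p : S → ℝ} (hp : ∀ i, 0 ≤ p i) (N : ℕ) {A : ℝ} (hA : 1 ≤ A) :
    ∃ (F : (Σ k : S → Fin (N + 1), Fin ⌊A * Real.exp (β * latticeEnergy E k)⌋₊) → ℝ)
      (π : Equiv.Perm (S × Σ k : S → Fin (N + 1), Fin ⌊A * Real.exp (β * latticeEnergy E k)⌋₊)),
      (∀ x, totalEnergy E F (π x) = totalEnergy E F x) ∧
      0 < ∑ b, Real.exp (-β * F b) ∧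
      ∑ b, Real.exp (-β * F b) ≤ A * (N + 1) ^ Fintype.card S ∧
      ∀ j, A * N ^ Fintype.card S * (∑ i, c i j * (p i * Real.exp (β * E i))) -
          ∑ K : S → Fin N, ∑ i, p i * Real.exp (β * E i) *
            Real.exp (-β * latticeEnergy E (fun l => (K l).succ)) ≤
        ∑ b, p (π.symm (j, b)).1 * Real.exp (-β * F (π.symm (j, b)).2) := by
  have hA0 : 0 ≤ A := by linarith
  let D : (S → Fin (N + 1)) → ℕ := fun k => ⌊A * Real.exp (β * latticeEnergy E k)⌋₊
  let F : (Σ k, Fin (D k)) → ℝ := fun b => latticeEnergy E b.1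
  let FK : (S → Fin N) → ℝ := fun K => latticeEnergy E (fun l => (K l).succ)
  have hFK : ∀ K i, latticeEnergy E (removeQuantum K i) = FK K - E i := fun K i => by
    have := latticeEnergy_removeQuantum E K i
    simp only [FK]
    linarith
  have hx : ∀ K, 0 ≤ A * Real.exp (β * FK K) := fun K => mul_nonneg hA0 (Real.exp_pos _).le
  have hG : ∀ K i, A * Real.exp (β * FK K) * Real.exp (-β * E i) =
      A * Real.exp (β * latticeEnergy E (removeQuantum K i)) := fun K i => by
    rw [mul_assoc, ← Real.exp_add, hFK]
    ring_nf
  have hsrc : ∀ K i, Nonempty ((Σ j, Fin ⌊A * Real.exp (β * FK K) * c i j⌋₊) ↪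
      Fin (D (removeQuantum K i))) := fun K i =>
    exists_embedding_fin (hx K) (hc i) (by rw [hrow, hG])
  have htgt : ∀ K j, Nonempty ((Σ i, Fin ⌊A * Real.exp (β * FK K) * c i j⌋₊) ↪
      Fin (D (removeQuantum K j))) := fun K j =>
    exists_embedding_fin (hx K) (fun i => hc i j) (by rw [hcol, hG])
  let src := fun K i => (hsrc K i).some
  let tgt := fun K j => (htgt K j).some
  -- The microstates to be moved from level `i` to level `j` within cell `K`, in number proportional
  -- to `c i j`. The row and column sums of `c` ensure that sources and targets fit into the bath
  -- degeneracies.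
  let T := Σ x : (S → Fin N) × S × S, Fin ⌊A * Real.exp (β * FK x.1) * c x.2.1 x.2.2⌋₊
  let a : T → S × Σ k, Fin (D k) := fun t =>
    (t.1.2.1, ⟨removeQuantum t.1.1 t.1.2.1, src t.1.1 t.1.2.1 ⟨t.1.2.2, t.2⟩⟩)
  let b : T → S × Σ k, Fin (D k) := fun t =>
    (t.1.2.2, ⟨removeQuantum t.1.1 t.1.2.2, tgt t.1.1 t.1.2.2 ⟨t.1.2.1, t.2⟩⟩)
  have ha : Function.Injective a := by
    rintro ⟨⟨K, i, j⟩, r⟩ ⟨⟨K', i', j'⟩, r'⟩ h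
    simp only [a, Prod.mk.injEq, Sigma.mk.injEq] at h
    obtain ⟨rfl, hK, hr⟩ := h
    obtain rfl := removeQuantum_injective i hK
    have := (src K i).injective (eq_of_heq hr)
    simp only [Sigma.mk.injEq] at this
    obtain ⟨rfl, hr⟩ := this
    rw [eq_of_heq hr]
  have hb : Function.Injective b := by
    rintro ⟨⟨K, i, j⟩, r⟩ ⟨⟨K', i', j'⟩, r'⟩ h
    simp only [b, Prod.mk.injEq, Sigma.mk.injEq] at h
    obtain ⟨rfl, hK, hr⟩ := h
    obtain rfl := removeQuantum_injective j hK
    have := (tgt K j).injective (eq_of_heq hr)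
    simp only [Sigma.mk.injEq] at this
    obtain ⟨rfl, hr⟩ := this
    rw [eq_of_heq hr]
  have hab : ∀ t, totalEnergy E F (a t) = totalEnergy E F (b t) := fun t => by
    simp only [totalEnergy, a, b, F, hFK]
    ring
  obtain ⟨π, hπ, hπE⟩ := exists_perm_extending (totalEnergy E F) ha hb hab
  have hZ : ∑ b, Real.exp (-β * F b) = ∑ k, (D k : ℝ) * Real.exp (-β * latticeEnergy E k) := by
    rw [Fintype.sum_sigma]
    simp [F]
  have hcancel : ∀ e : ℝ, Real.exp (β * e) * Real.exp (-β * e) = 1 := fun e => by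
    rw [← Real.exp_add]
    simp
  refine ⟨F, π, hπE, ?_, ?_, fun j => ?_⟩
  · have h0 : latticeEnergy E (fun _ : S => (0 : Fin (N + 1))) = 0 := by simp [latticeEnergy]
    have hD : 1 ≤ D fun _ => 0 := by
      refine Nat.le_floor ?_
      rw [h0]
      simpa using hA
    exact Finset.sum_pos (fun _ _ => Real.exp_pos _) ⟨⟨fun _ => 0, ⟨0, hD⟩⟩, Finset.mem_univ _⟩
  · rw [hZ]
    calc _ ≤ ∑ k : S → Fin (N + 1), A := by
          refine Finset.sum_le_sum fun k _ => ?_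
          calc _ ≤ A * Real.exp (β * latticeEnergy E k) * Real.exp (-β * latticeEnergy E k) := by
                gcongr
                exact Nat.floor_le (mul_nonneg hA0 (Real.exp_pos _).le)
            _ = A := by rw [mul_assoc, hcancel, mul_one]
      _ = A * (N + 1) ^ Fintype.card S := by
          simp [mul_comm]
  · let f : S × (Σ k, Fin (D k)) → ℝ := fun y => p y.1 * Real.exp (-β * F y.2)
    have hf : ∀ y, 0 ≤ f y := fun y => mul_nonneg (hp _) (Real.exp_pos _).le
    -- Only the transfers arriving at `j` are counted; the remaining microstates contribute
    -- nonnegative amounts. Rounding loses at most one microstate per `K` and `i`.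
    let Tj := Σ x : (S → Fin N) × S, Fin ⌊A * Real.exp (β * FK x.1) * c x.2 j⌋₊
    let up : Tj → T := fun t => ⟨(t.1.1, t.1.2, j), t.2⟩
    have hup : Function.Injective up := by
      rintro ⟨⟨K, i⟩, r⟩ ⟨⟨K', i'⟩, r'⟩ h
      obtain ⟨h1, hr⟩ := Sigma.mk.inj h
      obtain ⟨rfl, h2⟩ := Prod.mk.inj h1
      obtain ⟨rfl, -⟩ := Prod.mk.inj h2
      obtain rfl : r = r' := eq_of_heq hr
      rfl
    have hbj : ∀ t, b (up t) = (j, (b (up t)).2) := fun t => rfl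
    have hinj : Function.Injective fun t => (b (up t)).2 := by
      intro s t h
      refine hup (hb ?_)
      rw [hbj s, hbj t]
      exact Prod.ext rfl h
    calc _ = ∑ K : S → Fin N, ∑ i, (A * Real.exp (β * FK K) * c i j - 1) *
            (p i * (Real.exp (-β * FK K) * Real.exp (β * E i))) := by
          have hconst : A * (N : ℝ) ^ Fintype.card S * ∑ i, c i j * (p i * Real.exp (β * E i)) =
              ∑ K : S → Fin N, ∑ i, A * (c i j * (p i * Real.exp (β * E i))) := by
            rw [Finset.sum_const, ← Finset.mul_sum]
            simp
            ring
          rw [hconst, ← Finset.sum_sub_distrib]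
          refine Finset.sum_congr rfl fun K _ => ?_
          rw [← Finset.sum_sub_distrib]
          refine Finset.sum_congr rfl fun i _ => ?_
          linear_combination (-(A * (c i j * (p i * Real.exp (β * E i))))) * hcancel (FK K)
      _ ≤ ∑ K : S → Fin N, ∑ i, (⌊A * Real.exp (β * FK K) * c i j⌋₊ : ℝ) *
            (p i * (Real.exp (-β * FK K) * Real.exp (β * E i))) := by
          gcongr with K _ i _
          · exact mul_nonneg (hp i) (by positivity)
          · exact (Nat.sub_one_lt_floor _).le
      _ = ∑ t : Tj, f (a (up t)) := by
          rw [Fintype.sum_sigma, Fintype.sum_prod_type]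
          refine Finset.sum_congr rfl fun K _ => Finset.sum_congr rfl fun i _ => ?_
          have : ∀ r, f (a (up ⟨(K, i), r⟩)) =
              p i * (Real.exp (-β * FK K) * Real.exp (β * E i)) := fun r => by
            simp only [f, a, up, F, hFK]
            rw [← Real.exp_add]
            ring_nf
          rw [Finset.sum_congr rfl fun r _ => this r]
          simp
      _ = ∑ t : Tj, f (π.symm (j, (b (up t)).2)) := by
          refine Finset.sum_congr rfl fun t _ => ?_
          rw [← hbj, ← hπ, Equiv.symm_apply_apply]
      _ = ∑ y ∈ Finset.univ.image fun t => (b (up t)).2, f (π.symm (j, y)) := by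
          rw [Finset.sum_image fun s _ t _ h => hinj h]
      _ ≤ ∑ y, f (π.symm (j, y)) :=
          Finset.sum_le_sum_of_subset_of_nonneg (Finset.subset_univ _) fun y _ _ => hf _

end Bath

/-! ### Sufficiency: transitions from thermo-majorization -/

section Sufficiency

variable {S : Type*} [Fintype S] [DecidableEq S]

/-- A lower bound on each `q' j` is enough: once the total is also known to be one, as in the use
below, it forces closeness from above. -/
theorem exists_diagonal_mem_thermalOutputs {β : ℝ} {E : S → ℝ} {c : S → S → ℝ}
    (hc : ∀ i j, 0 ≤ c i j) (hrow : ∀ i, ∑ j, c i j = Real.exp (-β * E i))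
    (hcol : ∀ j, ∑ i, c i j = Real.exp (-β * E j)) {ρ : Matrix S S ℂ} {p q : S → ℝ}
    (hρ : ∀ i, ρ i i = p i) (hp : ∀ i, 0 ≤ p i) (hp1 : ∑ i, p i = 1) (hq1 : ∀ j, q j ≤ 1)
    (hq : ∀ j, ∑ i, c i j * (p i * Real.exp (β * E i)) = q j) {δ : ℝ} (hδ : 0 < δ) :
    ∃ q' : S → ℝ, Matrix.diagonal (fun j => (q' j : ℂ)) ∈ thermalOutputs β E ρ ∧
      ∑ j, q' j = 1 ∧ ∀ j, q j - δ ≤ q' j := by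
  set n := Fintype.card S
  have hlim : Filter.Tendsto (fun N : ℕ => ((N : ℝ) / (N + 1)) ^ n) Filter.atTop (nhds 1) := by
    simpa using (tendsto_natCast_div_add_atTop (1 : ℝ)).pow n
  -- The error is halved: a large box makes the boundary loss less than `δ / 2`, then large
  -- degeneracies `A` do the same for the rounding loss `R`, which is independent of `A`.
  obtain ⟨N, hN⟩ := (hlim.eventually_const_lt (show 1 - δ / 2 < 1 by linarith)).exists
  set R := ∑ K : S → Fin N, ∑ i, p i * Real.exp (β * E i) *
    Real.exp (-β * latticeEnergy E (fun l => (K l).succ))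
  set A := max 1 (2 * R / δ)
  have hA : 1 ≤ A := le_max_left _ _
  have hRA : R ≤ A * (δ / 2) := by
    have : 2 * R / δ ≤ A := le_max_right _ _
    rw [div_le_iff₀ hδ] at this
    linarith
  obtain ⟨F, π, hπ, hZ0, hZ, hlow⟩ := exists_bath_perm β E hc hrow hcol hp N hA
  set Z := ∑ b, Real.exp (-β * F b) with hZdef
  have hne : Nonempty (Σ k : S → Fin (N + 1), Fin ⌊A * Real.exp (β * latticeEnergy E k)⌋₊) := by
    by_contra h
    rw [not_nonempty_iff] at h
    rw [hZdef, Finset.univ_eq_empty, Finset.sum_empty] at hZ0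
    exact lt_irrefl _ hZ0
  refine ⟨fun j => ∑ b, p (π.symm (j, b)).1 * (Real.exp (-β * F (π.symm (j, b)).2) / Z),
    ?_, ?_, fun j => ?_⟩
  · convert diagonal_perm_mem_thermalOutputs β ρ F π hπ using 2
    ext j
    simp only [hρ, ← hZdef]
    push_cast
    rfl
  · rw [← Fintype.sum_prod_type' fun j b =>
      p (π.symm (j, b)).1 * (Real.exp (-β * F (π.symm (j, b)).2) / Z)]
    rw [π.symm.sum_comp fun y => p y.1 * (Real.exp (-β * F y.2) / Z), Fintype.sum_prod_type]
    simp only [← Finset.mul_sum, ← Finset.sum_div]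
    rw [← hZdef, div_self hZ0.ne']
    simpa using hp1
  · simp only [← mul_div_assoc]
    rw [← Finset.sum_div, le_div_iff₀ hZ0]
    rcases le_or_gt (q j - δ) 0 with hneg | hpos
    · exact (mul_nonpos_of_nonpos_of_nonneg hneg hZ0.le).trans
        (Finset.sum_nonneg fun b _ => mul_nonneg (hp _) (Real.exp_pos _).le)
    refine le_trans ?_ (hlow j)
    rw [hq]
    have hN1 : (1 : ℝ) ≤ (N + 1) ^ n := one_le_pow₀ (by linarith [(Nat.cast_nonneg N : (0:ℝ) ≤ N)])
    have hN2 : (1 - δ / 2) * ((N : ℝ) + 1) ^ n ≤ (N : ℝ) ^ n := by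
      rw [div_pow, lt_div_iff₀ (by linarith)] at hN
      exact hN.le
    have hq0 : 0 ≤ q j := by linarith
    calc (q j - δ) * Z ≤ (q j - δ) * (A * (N + 1) ^ n) := by gcongr
      _ ≤ A * (q j * ((1 - δ / 2) * (N + 1) ^ n)) - A * (δ / 2) * (N + 1) ^ n := by
        have : 0 ≤ A * ((N : ℝ) + 1) ^ n * (δ / 2) * (1 - q j) := by
          have := hq1 j
          have : 0 ≤ 1 - q j := by linarith
          positivity
        linarith
      _ ≤ A * (q j * N ^ n) - R := by
        have h1 : A * (q j * ((1 - δ / 2) * (N + 1) ^ n)) ≤ A * (q j * N ^ n) := by gcongr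
        have h2 : A * (δ / 2) * 1 ≤ A * (δ / 2) * (N + 1) ^ n := by gcongr
        linarith
      _ = A * N ^ n * q j - R := by ring

theorem mem_closure_diagonal_thermalOutputs {β : ℝ} {E : S → ℝ} {ρ : Matrix S S ℂ} {p q : S → ℝ}
    (hρ : ∀ i, ρ i i = p i) (hp : ∀ i, 0 ≤ p i) (hp1 : ∑ i, p i = 1) (hq : ∀ i, 0 ≤ q i)
    (hq1 : ∑ i, q i = 1)
    (h : ∀ t, 0 ≤ t → ∑ j, max (q j - t * Real.exp (-β * E j)) 0 ≤
      ∑ i, max (p i - t * Real.exp (-β * E i)) 0) :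
    q ∈ closure {q' : S → ℝ | Matrix.diagonal (fun j => (q' j : ℂ)) ∈ thermalOutputs β E ρ} := by
  have hne : Nonempty S := by
    by_contra hS
    rw [not_nonempty_iff] at hS
    simp at hp1
  have hcancel : ∀ i, Real.exp (-β * E i) * (p i * Real.exp (β * E i)) = p i := fun i => by
    rw [mul_left_comm, ← Real.exp_add]
    simp
  have hpt : ∀ t i, Real.exp (-β * E i) * max (p i * Real.exp (β * E i) - t) 0 =
      max (p i - t * Real.exp (-β * E i)) 0 := fun t i => by
    rw [mul_max_of_nonneg _ _ (Real.exp_pos _).le, mul_zero, mul_sub, hcancel, mul_comm t]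
  obtain ⟨c, hc, hrow, hcol, hcq⟩ := exists_coupling_of_excess_le
    (v := fun i => Real.exp (-β * E i)) (d := fun i => p i * Real.exp (β * E i))
    (w := fun j => Real.exp (-β * E j)) (m := q) (fun i => (Real.exp_pos _).le)
    (fun j => Real.exp_pos _) rfl (by simp only [hcancel, hp1, hq1]) (fun t => by
      simp only [hpt]
      rcases le_total 0 t with ht | ht
      · exact h t ht
      -- For `t ≤ 0` every positive part is the term itself, so both sides depend only on the equal
      -- totals.
      · have hmax : ∀ r : S → ℝ, (∀ i, 0 ≤ r i) → ∑ i, max (r i - t * Real.exp (-β * E i)) 0 =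
            ∑ i, r i - t * ∑ i, Real.exp (-β * E i) := by
          intro r hr
          rw [Finset.mul_sum, ← Finset.sum_sub_distrib]
          refine Finset.sum_congr rfl fun i _ => max_eq_left ?_
          have := mul_nonpos_of_nonpos_of_nonneg ht (Real.exp_pos (-β * E i)).le
          linarith [hr i]
        rw [hmax p hp, hmax q hq, hp1, hq1])
  rw [Metric.mem_closure_iff]
  intro ε hε
  set n : ℝ := (Fintype.card S : ℝ) with hn
  have hn0 : 0 ≤ n := Nat.cast_nonneg _
  set δ := ε / (n + 2)
  have hδ : 0 < δ := by positivity
  have hδε : (n + 2) * δ = ε := mul_div_cancel₀ _ (by positivity)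
  obtain ⟨q', hmem, hsum, hle⟩ := exists_diagonal_mem_thermalOutputs hc hrow hcol hρ hp hp1
    (fun j => hq1 ▸ Finset.single_le_sum (fun i _ => hq i) (Finset.mem_univ j)) hcq hδ
  refine ⟨q', hmem, (dist_pi_lt_iff hε).mpr fun j => ?_⟩
  -- All summands on the right are nonnegative and the totals of `q'` and `q` agree, so a single
  -- deviation is at most `(n - 1) * δ`.
  have h1 : q' j - q j + δ ≤ ∑ i, (q' i - q i + δ) :=
    Finset.single_le_sum (f := fun i => q' i - q i + δ) (fun i _ => by linarith [hle i])
      (Finset.mem_univ j)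
  rw [Finset.sum_add_distrib, Finset.sum_sub_distrib, hsum, hq1, Finset.sum_const,
    Finset.card_univ, nsmul_eq_mul, ← hn] at h1
  have h2 := hle j
  have h3 : 0 ≤ n * δ := by positivity
  rw [Real.dist_eq, abs_lt]
  constructor <;> linarith

/-- Thermo-majorization suffices for a transition to a block-diagonal state. -/
theorem transition_of_excess_le {β : ℝ} {E : S → ℝ} {ω : Fin 2 → ℝ} {ρ σ : DensityMatrix S}
    (hσ : IsBlockDiagonal E σ) {k l : Fin 2}
    (h : ∀ t, 0 ≤ t → excess β E σ (t * Real.exp (-β * ω l)) ≤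
      excess β E ρ (t * Real.exp (-β * ω k))) :
    Transition β (totalEnergy E ω) (ρ.val ⊗ₖ workState k) (σ.val ⊗ₖ workState l) := by
  have hKH : ∀ A : Matrix S S ℂ, (A ⊗ₖ (1 : Matrix (Fin 2) (Fin 2) ℂ)).conjTranspose =
      A.conjTranspose ⊗ₖ 1 := fun A => by
    rw [Matrix.conjTranspose_kronecker, Matrix.conjTranspose_one]
  have hU : ∀ τ : DensityMatrix S, energyBasis E τ ⊗ₖ (1 : Matrix (Fin 2) (Fin 2) ℂ) ∈
      Matrix.unitaryGroup (S × Fin 2) ℂ := fun τ => by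
    have := energyBasis_mem_unitaryGroup E τ
    rw [Matrix.mem_unitaryGroup_iff, Matrix.star_eq_conjTranspose] at this ⊢
    rw [hKH, ← Matrix.mul_kronecker_mul, this, Matrix.one_mul, Matrix.one_kronecker_one]
  have hU0 : ∀ τ : DensityMatrix S, ∀ x y, totalEnergy E ω x ≠ totalEnergy E ω y →
      (energyBasis E τ ⊗ₖ (1 : Matrix (Fin 2) (Fin 2) ℂ)) x y = 0 := by
    intro τ x y hxy
    rw [Matrix.kroneckerMap_apply, Matrix.one_apply]
    split_ifs with h
    · rw [energyBasis_apply_of_ne E τ fun hE => hxy (by rw [totalEnergy, totalEnergy, hE, h]),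
        zero_mul]
    · rw [mul_zero]
  let pop : DensityMatrix S → Fin 2 → S × Fin 2 → ℝ := fun τ m x =>
    if x.2 = m then population E τ x.1 else 0
  have hpop0 : ∀ τ m x, 0 ≤ pop τ m x := fun τ m x => by
    simp only [pop]
    split_ifs
    exacts [population_nonneg _ _ _, le_rfl]
  have hpop1 : ∀ τ m, ∑ x, pop τ m x = 1 := fun τ m => by
    simp only [pop, Fintype.sum_prod_type, Finset.sum_ite_eq', Finset.mem_univ, if_true]
    exact sum_population E τ
  -- The empty work level drops out because `t ≥ 0`; the occupied one rescales the argument of the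
  -- excess.
  have hexc : ∀ τ m t, 0 ≤ t → ∑ x, max (pop τ m x - t * Real.exp (-β * totalEnergy E ω x)) 0 =
      excess β E τ (t * Real.exp (-β * ω m)) := by
    intro τ m t ht
    rw [Fintype.sum_prod_type, excess]
    refine Finset.sum_congr rfl fun i _ => ?_
    rw [Finset.sum_eq_single m]
    · simp only [pop, if_true, totalEnergy, mul_add, Real.exp_add]
      ring_nf
    · intro r _ hr
      simp only [pop, if_neg hr, zero_sub]
      exact max_eq_right (neg_nonpos.mpr (mul_nonneg ht (Real.exp_pos _).le))
    · simp
  have hw : ∀ m, workState m = Matrix.diagonal fun r => if r = m then 1 else 0 := by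
    intro m
    ext i j
    fin_cases m <;> fin_cases i <;> fin_cases j <;> simp [workState, Matrix.single]
  have hdiag : ∀ x, ((energyBasis E ρ ⊗ₖ (1 : Matrix (Fin 2) (Fin 2) ℂ)).conjTranspose *
      (ρ.val ⊗ₖ workState k) * (energyBasis E ρ ⊗ₖ (1 : Matrix (Fin 2) (Fin 2) ℂ))) x x = pop ρ k x := by
    intro x
    rw [hKH, ← Matrix.mul_kronecker_mul, ← Matrix.mul_kronecker_mul, Matrix.one_mul,
      Matrix.mul_one, Matrix.kroneckerMap_apply, conj_energyBasis_apply E ρ rfl,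
      Matrix.diagonal_apply_eq, hw, Matrix.diagonal_apply_eq]
    simp only [pop]
    split_ifs <;> simp
  have hcl := mem_closure_diagonal_thermalOutputs (β := β) (q := pop σ l) hdiag (hpop0 ρ k)
    (hpop1 ρ k) (hpop0 σ l) (hpop1 σ l) fun t ht => by
      rw [hexc _ _ t ht, hexc _ _ t ht]
      exact h t ht
  let Φ : (S × Fin 2 → ℝ) → Matrix (S × Fin 2) (S × Fin 2) ℂ := fun q =>
    (energyBasis E σ ⊗ₖ 1) * Matrix.diagonal (fun j => (q j : ℂ)) *
      (energyBasis E σ ⊗ₖ 1).conjTranspose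
  have hΦ : Continuous Φ := by
    have : Continuous fun q : S × Fin 2 → ℝ => Matrix.diagonal (fun j => (q j : ℂ)) :=
      Continuous.matrix_diagonal (by fun_prop)
    exact (continuous_const.mul this).mul continuous_const
  have hΦσ : Φ (pop σ l) = σ.val ⊗ₖ workState l := by
    have hd : Matrix.diagonal (fun j => (pop σ l j : ℂ)) =
        Matrix.diagonal (fun i => (population E σ i : ℂ)) ⊗ₖ workState l := by
      rw [hw, Matrix.diagonal_kronecker_diagonal]
      congr 1
      ext j
      simp only [pop]
      split_ifs <;> simp
    simp only [Φ]
    rw [hd, hKH, ← Matrix.mul_kronecker_mul, ← Matrix.mul_kronecker_mul, Matrix.one_mul,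
      Matrix.mul_one, ← hσ.eq_conj_diagonal]
  rw [Transition, ← hΦσ]
  exact map_mem_closure hΦ hcl fun q hq => conj_mem_thermalOutputs (hU ρ) (hU0 ρ) (hU σ) (hU0 σ) hq

/-- A nonzero excess of `σ` is attained at an elbow, and the curve of `ρ` has a point at that
height, which bounds the excess of `ρ` from below. -/
theorem excess_le_of_horizontalMonotone_le {β : ℝ} {E : S → ℝ} {ρ σ : DensityMatrix S} {a b : ℝ}
    (hb : 0 < b) (h : ∀ m ∈ Set.Icc 1 (decoheredRank E σ),
      a * horizontalMonotone β E ρ (curveY β E σ m) ≤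
        b * horizontalMonotone β E σ (curveY β E σ m)) {t : ℝ} (ht : 0 ≤ t) :
    excess β E σ (t * b) ≤ excess β E ρ (t * a) := by
  rcases excess_eq_zero_or_elbow β E σ (mul_nonneg ht hb.le) with h0 | ⟨m, hm, hexc⟩
  · rw [h0]
    exact Finset.sum_nonneg fun i _ => le_max_right _ _
  · obtain ⟨hy, hx⟩ := horizontalMonotone_curveY β E σ hm
    have h1 := h m hm
    rw [hx] at h1
    have h2 := sub_mul_le_excess
      (exists_excess_eq_horizontalMonotone β E ρ hy (curveY_le_one β E σ m)).1 (t * a)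
    have h3 := mul_le_mul_of_nonneg_left h1 ht
    rw [hexc]
    linarith

/-- The sum of all slopes dominates each of them, so the excess vanishes there and the curve lies
below a line through the origin. -/
theorem horizontalMonotone_pos {β : ℝ} {E : S → ℝ} (ρ : DensityMatrix S) {y : ℝ}
    (hy : 0 < y) (hy1 : y ≤ 1) : 0 < horizontalMonotone β E ρ y := by
  have h := sub_mul_le_excess (exists_excess_eq_horizontalMonotone β E ρ hy hy1).1
    (∑ i, population E ρ i * Real.exp (β * E i))
  have hs0 : ∀ i, 0 ≤ population E ρ i * Real.exp (β * E i) := fun i =>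
    mul_nonneg (population_nonneg E ρ i) (Real.exp_pos _).le
  have h0 : excess β E ρ (∑ i, population E ρ i * Real.exp (β * E i)) = 0 := by
    refine Finset.sum_eq_zero fun i _ => max_eq_right ?_
    have h1 := mul_le_mul_of_nonneg_right
      (Finset.single_le_sum (fun i _ => hs0 i) (Finset.mem_univ i)) (Real.exp_pos (-β * E i)).le
    rw [mul_assoc, ← Real.exp_add, neg_mul, add_neg_cancel, Real.exp_zero, mul_one] at h1
    rw [neg_mul]
    linarith
  rw [h0] at h
  exact pos_of_mul_pos_right (lt_of_lt_of_le hy (by linarith))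
    (Finset.sum_nonneg fun i _ => hs0 i)

end Sufficiency

/-! ### From the gap of the work system to the factor `exp (-β W)` -/

section Work

variable {S : Type*} [Fintype S] [DecidableEq S]

/-- For either sign of `W`, the Boltzmann weight of the final work level is `exp (-β W)` times that
of the initial one, which unifies spending and charging. -/
theorem exp_workEnergy_of_nonpos (β : ℝ) {W : ℝ} (hW : W ≤ 0) :
    Real.exp (-β * workEnergy |W| 0) =
      Real.exp (-β * W) * Real.exp (-β * workEnergy |W| 1) := by
  rw [← Real.exp_add, abs_of_nonpos hW]
  simp [workEnergy]

theorem exp_workEnergy_of_pos (β : ℝ) {W : ℝ} (hW : 0 < W) :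
    Real.exp (-β * workEnergy |W| 1) =
      Real.exp (-β * W) * Real.exp (-β * workEnergy |W| 0) := by
  rw [← Real.exp_add, abs_of_pos hW]
  simp [workEnergy]

theorem horizontalMonotone_le_of_mem_achievableWork {β : ℝ} {E : S → ℝ} {ρ σ : DensityMatrix S}
    {W : ℝ} (h : W ∈ achievableWork β E ρ σ) {y : ℝ} (hy : y ∈ elbowHeights β E σ) :
    horizontalMonotone β E ρ y ≤ Real.exp (-β * W) * horizontalMonotone β E σ y := by
  obtain ⟨m, hm, rfl⟩ := hy
  rcases le_or_gt W 0 with hW | hW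
  · have := (h.1 hW).horizontalMonotone_le hm
    rw [exp_workEnergy_of_nonpos β hW, mul_comm (Real.exp (-β * W)), mul_assoc] at this
    exact le_of_mul_le_mul_left this (Real.exp_pos _)
  · have := (h.2 hW).horizontalMonotone_le hm
    rw [exp_workEnergy_of_pos β hW, mul_comm (Real.exp (-β * W)), mul_assoc] at this
    exact le_of_mul_le_mul_left this (Real.exp_pos _)

theorem mem_achievableWork_of_horizontalMonotone_le {β : ℝ} {E : S → ℝ} {ρ σ : DensityMatrix S}
    (hσ : IsBlockDiagonal E σ) {W : ℝ} (h : ∀ y ∈ elbowHeights β E σ,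
      horizontalMonotone β E ρ y ≤ Real.exp (-β * W) * horizontalMonotone β E σ y) :
    W ∈ achievableWork β E ρ σ := by
  refine ⟨fun hW => transition_of_excess_le hσ fun t ht =>
      excess_le_of_horizontalMonotone_le (Real.exp_pos _) (fun m hm => ?_) ht,
    fun hW => transition_of_excess_le hσ fun t ht =>
      excess_le_of_horizontalMonotone_le (Real.exp_pos _) (fun m hm => ?_) ht⟩
  · rw [exp_workEnergy_of_nonpos β hW, mul_comm (Real.exp (-β * W)), mul_assoc]
    exact mul_le_mul_of_nonneg_left (h _ ⟨m, hm, rfl⟩) (Real.exp_pos _).le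
  · rw [exp_workEnergy_of_pos β hW, mul_comm (Real.exp (-β * W)), mul_assoc]
    exact mul_le_mul_of_nonneg_left (h _ ⟨m, hm, rfl⟩) (Real.exp_pos _).le

end Work

end ThermalWork

end

theorem mainTheorem5 {S : Type*} [Fintype S] [DecidableEq S] (β : ℝ) (hβ : 0 < β) (E : S → ℝ)
    (ρ σ : ThermalWork.DensityMatrix S) :
    ∃ M : ℝ,
      IsGreatest ((fun y => ThermalWork.horizontalMonotone β E ρ y /
        ThermalWork.horizontalMonotone β E σ y) '' ThermalWork.elbowHeights β E σ) M ∧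
      (ThermalWork.IsBlockDiagonal E σ → ∃ W : ℝ,
        IsGreatest (ThermalWork.achievableWork β E ρ σ) W ∧
        ThermalWork.workOfTransition β E ρ σ = (W : EReal) ∧
        Real.exp (-β * W) = M) ∧
      ENNReal.ofReal M ≤ EReal.exp (-((β : EReal) * ThermalWork.workOfTransition β E ρ σ)) := by
  have hne : (ThermalWork.elbowHeights β E σ).Nonempty :=
    ⟨_, 1, ⟨le_rfl, ThermalWork.decoheredRank_pos E σ⟩, rfl⟩
  have hpos : ∀ (τ : ThermalWork.DensityMatrix S), ∀ y ∈ ThermalWork.elbowHeights β E σ,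
      0 < ThermalWork.horizontalMonotone β E τ y := by
    rintro τ _ ⟨m, hm, rfl⟩
    exact ThermalWork.horizontalMonotone_pos τ (ThermalWork.horizontalMonotone_curveY β E σ hm).1
      (ThermalWork.curveY_le_one β E σ m)
  obtain ⟨y₀, hy₀, hmax⟩ := Set.exists_max_image _ (fun y => ThermalWork.horizontalMonotone β E ρ y /
    ThermalWork.horizontalMonotone β E σ y)
    ((Set.finite_Icc 1 (ThermalWork.decoheredRank E σ)).image (ThermalWork.curveY β E σ)) hne
  set M := ThermalWork.horizontalMonotone β E ρ y₀ / ThermalWork.horizontalMonotone β E σ y₀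
  have hM : 0 < M := div_pos (hpos ρ y₀ hy₀) (hpos σ y₀ hy₀)
  set W := -Real.log M / β with hWdef
  have hWM : Real.exp (-β * W) = M := by
    have : -β * W = Real.log M := by
      rw [hWdef]
      field_simp
    rw [this, Real.exp_log hM]
  have hupper : ∀ V ∈ ThermalWork.achievableWork β E ρ σ, V ≤ W := by
    intro V hV
    have h := ThermalWork.horizontalMonotone_le_of_mem_achievableWork hV hy₀
    rw [← div_le_iff₀ (hpos σ y₀ hy₀)] at h
    have h' : Real.exp (-β * W) ≤ Real.exp (-β * V) := hWM.trans_le h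
    rw [Real.exp_le_exp] at h'
    exact le_of_mul_le_mul_left (by linarith : β * V ≤ β * W) hβ
  refine ⟨M, ⟨⟨y₀, hy₀, rfl⟩, ?_⟩, fun hσ => ?_, ?_⟩
  · rintro _ ⟨y, hy, rfl⟩
    exact hmax y hy
  · have hmem : W ∈ ThermalWork.achievableWork β E ρ σ := by
      refine ThermalWork.mem_achievableWork_of_horizontalMonotone_le hσ fun y hy => ?_
      rw [hWM, ← div_le_iff₀ (hpos σ y hy)]
      exact hmax y hy
    refine ⟨W, ⟨hmem, hupper⟩, ?_, hWM⟩
    refine IsGreatest.csSup_eq ⟨⟨W, hmem, rfl⟩, ?_⟩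
    rintro _ ⟨V, hV, rfl⟩
    exact EReal.coe_le_coe_iff.mpr (hupper V hV)
  · have hle : ThermalWork.workOfTransition β E ρ σ ≤ (W : EReal) := by
      refine sSup_le ?_
      rintro _ ⟨V, hV, rfl⟩
      exact EReal.coe_le_coe_iff.mpr (hupper V hV)
    -- Working in `EReal` covers the case without achievable work, where the supremum is `⊥` and the
    -- exponential is infinite.
    have h1 : ((-β * W : ℝ) : EReal) ≤ -((β : EReal) * ThermalWork.workOfTransition β E ρ σ) := by
      rw [neg_mul, EReal.coe_neg, EReal.coe_mul, EReal.neg_le_neg_iff]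
      exact mul_le_mul_of_nonneg_left hle (by exact_mod_cast hβ.le)
    refine le_trans (le_of_eq ?_) (EReal.exp_monotone h1)
    rw [EReal.exp_coe, hWM]
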